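/- **Setting.** Let $\Sigma_2=\{0,1\}^{\mathbb N}$ with the metric $d[s,t]=\sum_i|s_i-t_i|2^{-i}$ and shift map $\sigma$. Let $\Lambda\subset[0,1]$, let $h:\Lambda\to\Lambda$, and let $S:\Lambda\to\Sigma_2$ be a homeomorphism with $S\circ h=\sigma\circ S$. Assume that there is no $x\in\Lambda$ with $x=1$ and $h(x)=0$ (so that consecutive impulse moments below are distinct). Let $\Pi$ be the set of all sequences $\zeta=(\zeta_i)_{i\in\mathbb Z}$, $\zeta_i=i+\kappa_i$, where $\kappa_i\in\Lambda$ and $\kappa_{i+1}=h(\kappa_i)$ for all $i\in\mathbb Z$. The initial moment of $\zeta$ is $t_0=\zeta_0\in\Lambda$; for given $t_0$ the $\zeta_i$ with $i\ge0$ are determined, and all choices of preimages for $i<0$ are admitted. For $\zeta\in\Pi$ consider in $\mathbb R^n$ (Euclidean norm, operator norm for matrices) the problem $$z'=Az+f(z)\ (t\ne\zeta_i),\qquad \Delta z|_{t=\zeta_i}=Bz(\zeta_i)+W(z(\zeta_i)),\qquad z(t_0)=z_0,\qquad(1)$$ where solutions are left continuous, the equation holds at $\zeta_i$ for the left derivative,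 and $\Delta z|_{t=\zeta_i}=z(\zeta_i+)-z(\zeta_i)$. Let $\mathcal{PC}$ be the set of all solutions $z(t,t_0,z_0)$, $t\ge t_0$, with $t_0\in\Lambda$, $z_0\in\mathbb R^n$ (they use the impulses $i\ge0$). Let $\mathcal{PCB}$ be the set of solutions on $\mathbb R$, for some $\zeta\in\Pi$, that are bounded on $\mathbb R$. **Conditions.** Let $A,B$ be real $n\times n$ matrices, $f,W:\mathbb R^n\to\mathbb R^n$, $L>0$. * (C1) $\det(I+B)\neq0$. * (C2) $\|f(x_1)-f(x_2)\|+\|W(x_1)-W(x_2)\|\le L\|x_1-x_2\|$ for all $x_1,x_2$. * (C3) $Bx+W(x)\ne0$ for all $x\in\mathbb R^n$. * (C4) $M_0=\sup\|f\|+\sup\|W\|<\infty$. * (C5) $A,B$ commute and all eigenvalues of $A+\ln(I+B)$ have negative real part ($\ln(I+B)$ being a complex matrix logarithm of $I+B$ that commutes with $A$). Let $Z_\zeta(t,s)=e^{A(t-s)}(I+B)^{\#\{i:\,s\le\zeta_i<t\}}$ be the transition matrix of the linear part, and let $N,\omega>0$ be numbers, not depending on $\zeta\in\Pi$, such that $\|Z_\zeta(t,s)\|\le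 Ne^{-\omega(t-s)}$ for all $t\ge s$ and $\zeta\in\Pi$. Put $M_1=NM_0\big(\frac1\omega+\frac{e^\omega}{1-e^{-\omega}}\big)$, $\overline m=\max_{|u|\le1}\|e^{Au}\|$, $\underline m=\min_{|u|\le1}\|e^{Au}\|$, $\eta=\min_{\|x\|\le M_1}\|Bx+W(x)\|$, and let $q\ge3$ satisfy $\frac1q<\frac{2\underline m}{3\overline m}$. * (C6) $NL\big[\frac2\omega+\frac{e^\omega}{1-e^{-\omega}}\big]<1$. * (C7) $-\omega+NL+\ln(1+NL)<0$. * (C8) $L<\dfrac{\big[\frac{2\underline m}{3\overline m}-\frac1q\big]\underline m\,\eta}{2M_1(\overline m+\underline m)}$. **Closeness.** For an open interval $J$, a function $x$ with impulse moments $\zeta$ and a function $y$ with impulse moments $\zeta'$ are $\epsilon$-equivalent on $J$ if $\sup|\zeta_i-\zeta_i'|<\epsilon$ over all $i$ with $\zeta_i,\zeta_i'\in J$, and $\|x(t)-y(t)\|<\epsilon$ for all $t\in J$ that do not lie in the closed interval between $\zeta_i$ and $\zeta'_i$ for any such $i$. **Theorem.** Assume (C1)–(C8). Then problem (1) is chaotic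 on $\Lambda$, that is: 1. $\mathcal{PCB}$ is a chaotic attractor: * (attractor with basin $\mathcal{PC}$) for every $\zeta\in\Pi$ there is exactly one bounded solution on $\mathbb R$, and $\mathcal{PCB}$ is uniformly bounded; for every $\zeta\in\Pi$ and $z_0\in\mathbb R^n$ the solution of (1) on $[t_0,\infty)$ exists and is unique, and its distance to the bounded solution with the same $\zeta$ tends to $0$ as $t\to\infty$; * (sensitivity) there are $\epsilon_0,\epsilon_1>0$ such that for every $z\in\mathcal{PCB}$, with moments $\zeta$ and $t_0=\zeta_0$, and every $\delta>0$ there are $t_1\in\Lambda$ with $|t_0-t_1|<\delta$ and an interval $Q\subset[t_0,\infty)\cap[t_1,\infty)$ of length at least $\epsilon_1$ such that for every $z_1\in\mathcal{PCB}$ with initial moment $t_1$ one has $\|z(t)-z_1(t)\|\ge\epsilon_0$ on $Q$, and $Q$ contains no impulse moments of $z,z_1$; * (density of periodic solutions) for every $z\in\mathcal{PCB}$ and $\epsilon,E>0$ there are $\phi\in\mathcal{PCB}$ whose impulse moments satisfy $\zeta_{i+p}=\zeta_i+p$ for all $i$ and which is $p$-periodic, for some integer $p\ge1$, and an open interval $J$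 of length $E$, to the right of both initial moments, such that $\phi$ and $z$ are $\epsilon$-equivalent on $J$; * (dense solution) there is $z\in\mathcal{PCB}$ such that for every $z_1\in\mathcal{PCB}$ and $\epsilon,E>0$ there are an open interval $J$ of length $E$ and an integer $m$, with $J$ and $J+m$ to the right of the initial moments of $z_1$ and $z$ respectively, such that $z(\cdot+m)$ (with moments $\zeta_{i+m}-m$) is $\epsilon$-equivalent to $z_1$ on $J$. 2. (1) is sensitive: there are $\kappa_0,\kappa_1>0$ such that for every $z=z(\cdot,t_0,z_0)\in\mathcal{PC}$ and all $\delta,H>0$ there are $t_1\in\Lambda$ with $|t_0-t_1|<\delta$ and an interval $Q\subset[t_0,\infty)\cap[t_1,\infty)$ of length at least $\kappa_1$ such that for all solutions $z_1=z(\cdot,t_1,z_1^0)$ with $\|z_0-z_1^0\|<H$ one has $\|z_1(t)-z(t)\|\ge\kappa_0$ on $Q$, and $Q$ contains no impulse moments of $z,z_1$. 3. The periodic solutions are dense in $\mathcal{PC}$: the density statement of item 1 holds for every $z\in\mathcal{PC}$, with $\phi\in\mathcal{PCB}$ as there. 4. Some solution $z\in\mathcal{PC}$ is dense in the set of all orbits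 of $\mathcal{PC}$: the dense-solution statement of item 1 holds with $\mathcal{PC}$ in place of $\mathcal{PCB}$. -/

import Mathlib

open Set Filter Topology

noncomputable section

/-! ### Symbolic dynamics and the moments of impulses -/

/-- The shift map on the space of one-sided binary sequences.  The space `ℕ → Fin 2` carries the
product topology, which is the topology of the metric `∑ |s i - t i| / 2 ^ i`. -/
def shiftMap (s : ℕ → Fin 2) : ℕ → Fin 2 := fun i => s (i + 1)

/-- The set of all impulse sequences `ζ i = i + κ i`, where `κ` runs over all two-sided orbits of
`h`, i.e. `κ (i + 1) = h (κ i)` for all integers `i`.  (Going forward `κ` is determined by `κ 0`,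
going backward a preimage under `h` is chosen at every step, and all choices are admitted.)
The initial moment that belongs to `ζ` is `ζ 0 = κ 0`, a point of `Λ`. -/
def impulseSequences {Λ : Set ℝ} (h : Λ → Λ) : Set (ℤ → ℝ) :=
  {ζ | ∃ κ : ℤ → Λ, (∀ i, κ (i + 1) = h (κ i)) ∧ ∀ i, ζ i = (i : ℝ) + (κ i : ℝ)}

/-- The periodicity property of an impulse sequence, with period `p`. -/
def HasPeriod (ζ : ℤ → ℝ) (p : ℕ) : Prop :=
  ∀ i : ℤ, ζ (i + p) = ζ i + p

/-! ### Impulsive differential equations and their solutions -/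

/-- The data of the impulsive equation
`z' = A z + f z` for `t ≠ θ i`, `Δ z = B z + W z` at `t = θ i`. -/
structure ImpulsiveSystem (n : ℕ) where
  A : Matrix (Fin n) (Fin n) ℝ
  B : Matrix (Fin n) (Fin n) ℝ
  f : EuclideanSpace ℝ (Fin n) → EuclideanSpace ℝ (Fin n)
  W : EuclideanSpace ℝ (Fin n) → EuclideanSpace ℝ (Fin n)

namespace ImpulsiveSystem

variable {n : ℕ} (P : ImpulsiveSystem n)

/-- The operator `x ↦ A x` on Euclidean space. -/
def opA : EuclideanSpace ℝ (Fin n) →L[ℝ] EuclideanSpace ℝ (Fin n) :=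
  Matrix.toEuclideanCLM (𝕜 := ℝ) P.A

/-- The operator `x ↦ B x` on Euclidean space. -/
def opB : EuclideanSpace ℝ (Fin n) →L[ℝ] EuclideanSpace ℝ (Fin n) :=
  Matrix.toEuclideanCLM (𝕜 := ℝ) P.B

/-- `z` is a solution on the whole line, with the sequence of impulse moments `θ`: the differential
equation holds off the moments `θ i`, it holds at `θ i` for the left derivative (so that `z` is left
continuous), and the right limit at `θ i` exists and differs from `z (θ i)` by the prescribed
jump. -/
def IsSolution (θ : ℤ → ℝ) (z : ℝ → EuclideanSpace ℝ (Fin n)) : Prop :=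
  (∀ t, (∀ i, t ≠ θ i) → HasDerivAt z (P.opA (z t) + P.f (z t)) t) ∧
  (∀ i, HasDerivWithinAt z (P.opA (z (θ i)) + P.f (z (θ i))) (Iic (θ i)) (θ i)) ∧
  (∀ i, Tendsto z (𝓝[>] (θ i)) (𝓝 (z (θ i) + (P.opB (z (θ i)) + P.W (z (θ i))))))

/-- `z` is a solution on `[θ 0, ∞)`, with the impulse moments `θ i`, `i ≥ 0`.  (The values of `z`
to the left of `θ 0` play no role.)  The solution `z(t, t₀, z₀)` of the initial value problem is the
one with `θ 0 = t₀` and `z (θ 0) = z₀`. -/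
def IsForwardSolution (θ : ℤ → ℝ) (z : ℝ → EuclideanSpace ℝ (Fin n)) : Prop :=
  (∀ t, θ 0 < t → (∀ i, 0 ≤ i → t ≠ θ i) → HasDerivAt z (P.opA (z t) + P.f (z t)) t) ∧
  (∀ i, 0 < i → HasDerivWithinAt z (P.opA (z (θ i)) + P.f (z (θ i))) (Iic (θ i)) (θ i)) ∧
  (∀ i, 0 ≤ i →
    Tendsto z (𝓝[>] (θ i)) (𝓝 (z (θ i) + (P.opB (z (θ i)) + P.W (z (θ i))))))

/-- `z` is a solution on the whole line that is bounded there. -/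
def IsBoundedSolution (θ : ℤ → ℝ) (z : ℝ → EuclideanSpace ℝ (Fin n)) : Prop :=
  P.IsSolution θ z ∧ ∃ M : ℝ, ∀ t, ‖z t‖ ≤ M

/-! ### The constants and the conditions -/

/-- The real parts of all eigenvalues of `A + ln (I + B)` are negative.  Here `ln (I + B)` is a
complex logarithm of `I + B` that commutes with `A`, as every logarithm given by the functional
calculus does when `A` and `B` commute.  The real parts in question are
the same for all such logarithms. -/
def NegativeSpectrum : Prop :=
  ∃ X : Matrix (Fin n) (Fin n) ℂ,
    NormedSpace.exp X = (1 + P.B).map Complex.ofReal ∧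
    Commute (P.A.map Complex.ofReal) X ∧
    ∀ μ ∈ spectrum ℂ (P.A.map Complex.ofReal + X), μ.re < 0

/-- The transition matrix `Z(t, s)`, `s ≤ t`, of the linear homogeneous system `z' = A z` for
`t ≠ θ i`, `Δ z = B z` at `t = θ i`, for commuting `A` and `B`: solutions are left continuous, so
that the jumps between `s` and `t` are those with `s ≤ θ i < t`. -/
def transition (θ : ℤ → ℝ) (t s : ℝ) :
    EuclideanSpace ℝ (Fin n) →L[ℝ] EuclideanSpace ℝ (Fin n) :=
  NormedSpace.exp ((t - s) • P.opA) * (1 + P.opB) ^ {i : ℤ | s ≤ θ i ∧ θ i < t}.ncard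

/-- `sup ‖f‖ + sup ‖W‖`. -/
def M₀ : ℝ := (⨆ x, ‖P.f x‖) + ⨆ x, ‖P.W x‖

/-- `N M₀ (1 / ω + e ^ ω / (1 - e ^ (-ω)))`. -/
def M₁ (N ω : ℝ) : ℝ :=
  N * P.M₀ * (1 / ω + Real.exp ω / (1 - Real.exp (-ω)))

/-- `max ‖e ^ (A u)‖` over `|u| ≤ 1`. -/
def mUpper : ℝ := sSup ((fun u : ℝ => ‖NormedSpace.exp (u • P.opA)‖) '' Icc (-1) 1)

/-- `min ‖e ^ (A u)‖` over `|u| ≤ 1`. -/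
def mLower : ℝ := sInf ((fun u : ℝ => ‖NormedSpace.exp (u • P.opA)‖) '' Icc (-1) 1)

/-- `min ‖B x + W x‖` over `‖x‖ ≤ r`. -/
def minJump (r : ℝ) : ℝ :=
  sInf ((fun x => ‖P.opB x + P.W x‖) '' Metric.closedBall 0 r)

end ImpulsiveSystem

/-! ### Closeness of piecewise continuous functions -/

/-- `ε`-equivalence on the open interval `J = (a, b)` of a function `x` with discontinuity moments
`ζ` and a function `y` with discontinuity moments `η`.  The first clause says that the supremum of
`|ζ i - η i|` over the (finitely many) `i` with `ζ i, η i ∈ J` is less than `ε`. -/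
def EpsEquivalent {E : Type*} [NormedAddCommGroup E] (ε a b : ℝ) (ζ : ℤ → ℝ) (x : ℝ → E)
    (η : ℤ → ℝ) (y : ℝ → E) : Prop :=
  (∀ i, ζ i ∈ Ioo a b → η i ∈ Ioo a b → |ζ i - η i| < ε) ∧
  ∀ t ∈ Ioo a b, (∀ i, ζ i ∈ Ioo a b → η i ∈ Ioo a b → t ∉ uIcc (ζ i) (η i)) →
    ‖x t - y t‖ < ε

namespace ImpulsiveSystem

variable {n : ℕ} (P : ImpulsiveSystem n) {Λ : Set ℝ} (h : Λ → Λ)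

/-! ### The attractor of bounded solutions -/

/-- `z` is a periodic solution `φ(t, t₀)`: the bounded solution that belongs to an
impulse sequence with the periodicity property, and it is periodic with the same period. -/
def IsPeriodicSolution (ζ : ℤ → ℝ) (z : ℝ → EuclideanSpace ℝ (Fin n)) : Prop :=
  P.IsBoundedSolution ζ z ∧ ∃ p : ℕ, 0 < p ∧ HasPeriod ζ p ∧ ∀ t, z (t + p) = z t

/-- The set `PCB` of bounded solutions `z(t, t₀)` is a bounded attractor whose basin is the set `PC`
of all solutions `z(t, t₀, z₀)`, `t₀ ∈ Λ`:
every impulse sequence has exactly one bounded solution; these solutions are uniformly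
bounded; the solution with any given initial value exists and is unique on `[t₀, ∞)`; and
it is attracted by the bounded solution with the same impulse moments. -/
def IsAttractorPCB : Prop :=
  (∀ ζ ∈ impulseSequences h, ∃! z, P.IsBoundedSolution ζ z) ∧
  (∃ M : ℝ, ∀ ζ ∈ impulseSequences h, ∀ z, P.IsBoundedSolution ζ z → ∀ t, ‖z t‖ ≤ M) ∧
  (∀ ζ ∈ impulseSequences h, ∀ z₀ : EuclideanSpace ℝ (Fin n),
    ∃ z, P.IsForwardSolution ζ z ∧ z (ζ 0) = z₀) ∧
  (∀ ζ ∈ impulseSequences h, ∀ z₁ z₂, P.IsForwardSolution ζ z₁ → P.IsForwardSolution ζ z₂ →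
    z₁ (ζ 0) = z₂ (ζ 0) → EqOn z₁ z₂ (Ici (ζ 0))) ∧
  (∀ ζ ∈ impulseSequences h, ∀ z z₁, P.IsBoundedSolution ζ z → P.IsForwardSolution ζ z₁ →
    Tendsto (fun t => ‖z t - z₁ t‖) atTop (𝓝 0))

/-- Sensitivity on `PCB`; the interval `Q` is `[a, b]`. -/
def SensitiveOnPCB : Prop :=
  ∃ ε₀ > 0, ∃ ε₁ > 0, ∀ ζ ∈ impulseSequences h, ∀ z, P.IsBoundedSolution ζ z →
    ∀ δ > 0, ∃ t₁ ∈ Λ, |ζ 0 - t₁| < δ ∧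
      ∃ a b : ℝ, ζ 0 ≤ a ∧ t₁ ≤ a ∧ ε₁ ≤ b - a ∧ (∀ i, ζ i ∉ Icc a b) ∧
        ∀ η ∈ impulseSequences h, η 0 = t₁ → (∀ i, η i ∉ Icc a b) ∧
          ∀ z₁, P.IsBoundedSolution η z₁ → ∀ t ∈ Icc a b, ε₀ ≤ ‖z t - z₁ t‖

/-- Periodic solutions are dense in `PCB`; the interval `J` is `(a, a + E)`. -/
def PeriodicDenseInPCB : Prop :=
  ∀ ζ ∈ impulseSequences h, ∀ z, P.IsBoundedSolution ζ z → ∀ ε > 0, ∀ E > 0,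
    ∃ η ∈ impulseSequences h, ∃ φ, P.IsPeriodicSolution η φ ∧
      ∃ a : ℝ, ζ 0 ≤ a ∧ η 0 ≤ a ∧ EpsEquivalent ε a (a + E) η φ ζ z

/-- There is a bounded solution that is dense in the set of all orbits of `PCB`.  The shift of the
argument by `m` turns the impulse moments `ζ i` into `ζ (i + m) - m`. -/
def HasDenseOrbitInPCB : Prop :=
  ∃ ζ ∈ impulseSequences h, ∃ z, P.IsBoundedSolution ζ z ∧
    ∀ η ∈ impulseSequences h, ∀ z₁, P.IsBoundedSolution η z₁ → ∀ ε > 0, ∀ E > 0,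
      ∃ (m : ℤ) (a : ℝ), η 0 ≤ a ∧ ζ 0 ≤ a + m ∧
        EpsEquivalent ε a (a + E) (fun i => ζ (i + m) - m) (fun t => z (t + m)) η z₁

/-- `PCB` is a chaotic attractor. -/
def IsChaoticAttractorPCB : Prop :=
  P.IsAttractorPCB h ∧ P.SensitiveOnPCB h ∧ P.PeriodicDenseInPCB h ∧ P.HasDenseOrbitInPCB h

/-! ### Chaos of the initial value problem -/

/-- Sensitivity of the initial value problem on `Λ`; the interval `Q` is `[a, b]`. -/
def SensitiveOnPC : Prop :=
  ∃ κ₀ > 0, ∃ κ₁ > 0, ∀ ζ ∈ impulseSequences h, ∀ z, P.IsForwardSolution ζ z →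
    ∀ δ > 0, ∀ H > 0, ∃ t₁ ∈ Λ, |ζ 0 - t₁| < δ ∧
      ∃ a b : ℝ, ζ 0 ≤ a ∧ t₁ ≤ a ∧ κ₁ ≤ b - a ∧ (∀ i, ζ i ∉ Icc a b) ∧
        ∀ η ∈ impulseSequences h, η 0 = t₁ → (∀ i, η i ∉ Icc a b) ∧
          ∀ z₁, P.IsForwardSolution η z₁ → ‖z (ζ 0) - z₁ (η 0)‖ < H →
            ∀ t ∈ Icc a b, κ₀ ≤ ‖z₁ t - z t‖

/-- Periodic solutions are dense in `PC`; the interval `J` is `(a, a + E)`. -/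
def PeriodicDenseInPC : Prop :=
  ∀ ζ ∈ impulseSequences h, ∀ z, P.IsForwardSolution ζ z → ∀ ε > 0, ∀ E > 0,
    ∃ η ∈ impulseSequences h, ∃ φ, P.IsPeriodicSolution η φ ∧
      ∃ a : ℝ, ζ 0 ≤ a ∧ η 0 ≤ a ∧ EpsEquivalent ε a (a + E) η φ ζ z

/-- There is a solution of the initial value problem that is dense in the set of all orbits
of `PC`. -/
def HasDenseOrbitInPC : Prop :=
  ∃ ζ ∈ impulseSequences h, ∃ z, P.IsForwardSolution ζ z ∧
    ∀ η ∈ impulseSequences h, ∀ z₁, P.IsForwardSolution η z₁ → ∀ ε > 0, ∀ E > 0,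
      ∃ (m : ℤ) (a : ℝ), η 0 ≤ a ∧ ζ 0 ≤ a + m ∧
        EpsEquivalent ε a (a + E) (fun i => ζ (i + m) - m) (fun t => z (t + m)) η z₁

/-- The initial value problem is chaotic on `Λ`. -/
def IsChaotic : Prop :=
  P.IsChaoticAttractorPCB h ∧ P.SensitiveOnPC h ∧ P.PeriodicDenseInPC h ∧ P.HasDenseOrbitInPC h

end ImpulsiveSystem

end

/-! The equation forgets its state exponentially fast, while the impulse moments carry the shift
dynamics. After a transient a solution is therefore governed by its moments alone, and density and
sensitivity become statements about binary codes.

Forgetting: record the state just after each impulse, so that a solution becomes an orbit of the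
nonautonomous recursion `postMap`. Measure the difference w of two such states at the moment x by
sup e^{ω(t-x)}‖Z(t,x+)w‖, which lies between ‖w‖ and N‖w‖. In this norm the linear system contracts
by e^{-ωl} over a gap of length l, with no factor N; Grönwall's inequality adds e^{NLl} for f and
the jump adds 1+NL for W. Thus (C7) makes the rate (1+NL)e^{-(ω-NL)} smaller than one, and N enters
only once, in the constant (`isContractingEvolution_postMap`). Pull-back limits give the bounded
solutions, and contraction gives their uniqueness and attraction.

Density: an orbit for slightly different moments is an approximate orbit of the recursion, and
contraction sums the errors to a geometric series (`norm_sub_le_of_approx`). A long common code word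
keeps the moments close for a long time and so yields ε-equivalence (`exists_epsEquivalent`).
Periodic codes give periodic solutions, and a code containing all finite words gives a dense
solution.

Sensitivity: changing one distant symbol of the code eventually separates corresponding moments. At
an impulse of one solution that is away from the impulses of the other, the first jumps by at least
some J > 0, by (C3) and compactness, while the second is continuous; they cannot be close on both
sides of the impulse (`exists_separation`). -/

noncomputable section

/-! ### Flows of Lipschitz vector fields on the time interval `[0, 2]` -/

section Flow

variable {E : Type*} [NormedAddCommGroup E] [NormedSpace ℝ E]

/-- `φ x` is the solution of `x' = v x` with initial value `x` on the time interval `[0, 2]`. -/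
structure IsLocalFlow (v : E → E) (φ : E → ℝ → E) : Prop where
  zero : ∀ x, φ x 0 = x
  hasDerivAt : ∀ x, ∀ t ∈ Icc (0 : ℝ) 2, HasDerivAt (φ x) (v (φ x t)) t

theorem exp_smul_mul_exp_smul [CompleteSpace E] (A : E →L[ℝ] E) (a b : ℝ) :
    NormedSpace.exp (a • A) * NormedSpace.exp (b • A) = NormedSpace.exp ((a + b) • A) := by
  let _ : NormedAlgebra ℚ (E →L[ℝ] E) := NormedAlgebra.restrictScalars ℚ ℝ _
  rw [← NormedSpace.exp_add_of_commute (((Commute.refl A).smul_left _).smul_right _), ← add_smul]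

open scoped NNReal in
/-- A linear vector field with a bounded Lipschitz perturbation has a flow on `[0, 2]`. -/
theorem exists_isLocalFlow [CompleteSpace E] (A : E →L[ℝ] E) {f : E → E} {K : ℝ≥0}
    (hf : LipschitzWith K f) {M : ℝ} (hM : ∀ x, ‖f x‖ ≤ M) :
    ∃ φ, IsLocalFlow (fun x => A x + f x) φ := by
  have hexp : Continuous fun t : ℝ => NormedSpace.exp (t • A) :=
    (differentiable_exp_smul_const ℝ A).continuous
  have hexp' : Continuous fun t : ℝ => NormedSpace.exp ((-t) • A) :=
    hexp.comp continuous_neg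
  obtain ⟨c₁, hc₁⟩ := (isCompact_Icc (a := (-1 : ℝ)) (b := 3)).exists_bound_of_continuousOn
    hexp.continuousOn
  obtain ⟨c₂, hc₂⟩ := (isCompact_Icc (a := (-1 : ℝ)) (b := 3)).exists_bound_of_continuousOn
    hexp'.continuousOn
  have hc₁' : 0 ≤ c₁ := (norm_nonneg _).trans (hc₁ 0 (by norm_num))
  have hc₂' : 0 ≤ c₂ := (norm_nonneg _).trans (hc₂ 0 (by norm_num))
  have hM' : 0 ≤ M := (norm_nonneg _).trans (hM 0)
  -- The substitution x = e^{tA}u removes the linear part. The new field is bounded as well as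
  -- Lipschitz on [-1, 3], so a single Picard–Lindelöf step covers the interval: the radius is the
  -- bound of the field times 3, the largest distance from time 0. The margin around [0, 2] gives
  -- two-sided derivatives at its ends.
  let g : ℝ → E → E := fun t u =>
    NormedSpace.exp ((-t) • A) (f (NormedSpace.exp (t • A) u))
  have h0 : (0 : ℝ) ∈ Icc (-1 : ℝ) 3 := by norm_num
  have hPL : ∀ x : E, IsPicardLindelof g (⟨0, h0⟩ : Icc (-1 : ℝ) 3) x
      (c₂.toNNReal * M.toNNReal * 3) 0 (c₂.toNNReal * M.toNNReal)
      (c₂.toNNReal * (K * c₁.toNNReal)) := by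
    intro x
    refine ⟨fun t ht => ?_, fun y _ => ?_, fun t ht y _ => ?_, ?_⟩
    · refine LipschitzWith.lipschitzOnWith ?_
      have h1 : LipschitzWith c₁.toNNReal (NormedSpace.exp (t • A) : E →L[ℝ] E) :=
        (NormedSpace.exp (t • A) : E →L[ℝ] E).lipschitz.weaken
          (by rw [← NNReal.coe_le_coe]; simpa [hc₁'] using hc₁ t ht)
      have h2 : LipschitzWith c₂.toNNReal (NormedSpace.exp ((-t) • A) : E →L[ℝ] E) :=
        (NormedSpace.exp ((-t) • A) : E →L[ℝ] E).lipschitz.weaken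
          (by rw [← NNReal.coe_le_coe]; simpa [hc₂'] using hc₂ t ht)
      exact h2.comp (hf.comp h1)
    · refine Continuous.continuousOn ?_
      have := hf.continuous
      exact hexp'.clm_apply (this.comp (hexp.clm_apply continuous_const))
    · simp only [NNReal.coe_mul, Real.coe_toNNReal _ hc₂', Real.coe_toNNReal _ hM']
      exact (ContinuousLinearMap.le_opNorm _ _).trans
        (mul_le_mul (hc₂ t ht) (hM _) (norm_nonneg _) hc₂')
    · simp
  have hsol : ∀ x : E, ∃ φ : ℝ → E, φ 0 = x ∧
      ∀ t ∈ Icc (0 : ℝ) 2, HasDerivAt φ (A (φ t) + f (φ t)) t := by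
    intro x
    obtain ⟨u, hu0, hu⟩ := (hPL x).exists_eq_forall_mem_Icc_hasDerivWithinAt₀
    refine ⟨fun t => NormedSpace.exp (t • A) (u t), by simpa using hu0, fun t ht => ?_⟩
    have h1 := hasDerivAt_exp_smul_const' (𝕂 := ℝ) A t
    have h2 : HasDerivAt u (g t (u t)) t :=
      (hu t ⟨by linarith [ht.1], by linarith [ht.2]⟩).hasDerivAt
        (Icc_mem_nhds (by linarith [ht.1]) (by linarith [ht.2]))
    have h3 := h1.clm_apply h2
    convert h3 using 1
    have h4 : NormedSpace.exp (t • A) * NormedSpace.exp ((-t) • A) = 1 := by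
      rw [exp_smul_mul_exp_smul, add_neg_cancel, zero_smul, NormedSpace.exp_zero]
    have h5 : ∀ y, NormedSpace.exp (t • A) (NormedSpace.exp ((-t) • A) y) = y := fun y => by
      rw [← mul_apply_eq_comp, h4]; rfl
    simp only [g, h5, mul_apply_eq_comp]
  choose φ hφ using hsol
  exact ⟨φ, fun x => (hφ x).1, fun x => (hφ x).2⟩

namespace IsLocalFlow

open scoped NNReal

variable {v : E → E} {φ : E → ℝ → E} {K : ℝ≥0}

theorem continuousOn (hφ : IsLocalFlow v φ) (x : E) : ContinuousOn (φ x) (Icc 0 2) :=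
  fun t ht => (hφ.hasDerivAt x t ht).continuousAt.continuousWithinAt

theorem norm_sub_le (hφ : IsLocalFlow v φ) (hv : LipschitzWith K v) (x y : E) {t : ℝ}
    (ht : t ∈ Icc (0 : ℝ) 2) : ‖φ x t - φ y t‖ ≤ Real.exp (K * 2) * ‖x - y‖ := by
  have h := dist_le_of_trajectories_ODE (v := fun _ => v) (K := K) (fun _ => hv)
    (hφ.continuousOn x) (fun s hs => (hφ.hasDerivAt x s ⟨hs.1, hs.2.le⟩).hasDerivWithinAt)
    (hφ.continuousOn y) (fun s hs => (hφ.hasDerivAt y s ⟨hs.1, hs.2.le⟩).hasDerivWithinAt)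
    le_rfl t ht
  rw [dist_eq_norm, hφ.zero, hφ.zero, dist_eq_norm, sub_zero, mul_comm] at h
  refine h.trans ?_
  gcongr
  exact ht.2

/-- The flow is bounded on bounded sets. -/
theorem norm_le (hφ : IsLocalFlow v φ) (hv : LipschitzWith K v) {x : E} {R : ℝ} (hx : ‖x‖ ≤ R)
    {t : ℝ} (ht : t ∈ Icc (0 : ℝ) 2) : ‖φ x t‖ ≤ gronwallBound R K ‖v 0‖ 2 := by
  have h := norm_le_gronwallBound_of_norm_deriv_right_le (δ := R) (K := K) (ε := ‖v 0‖)
    (hφ.continuousOn x) (fun s hs => (hφ.hasDerivAt x s ⟨hs.1, hs.2.le⟩).hasDerivWithinAt)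
    (by rwa [hφ.zero]) (fun s _ => ?_) t ht
  · exact h.trans (gronwallBound_mono ((norm_nonneg x).trans hx) (norm_nonneg _) K.coe_nonneg
      (by linarith [ht.2]))
  · have := hv.norm_sub_le (φ x s) 0
    rw [sub_zero] at this
    linarith [norm_le_norm_sub_add (v (φ x s)) (v 0)]

/-- The flow is Lipschitz in time, uniformly on bounded sets. -/
theorem norm_sub_time_le (hφ : IsLocalFlow v φ) (hv : LipschitzWith K v) {x : E} {R : ℝ}
    (hx : ‖x‖ ≤ R) {s t : ℝ} (hs : s ∈ Icc (0 : ℝ) 2) (ht : t ∈ Icc (0 : ℝ) 2) :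
    ‖φ x t - φ x s‖ ≤ (K * gronwallBound R K ‖v 0‖ 2 + ‖v 0‖) * |t - s| := by
  refine (convex_Icc (0 : ℝ) 2).norm_image_sub_le_of_norm_hasDerivWithin_le
    (fun r hr => (hφ.hasDerivAt x r hr).hasDerivWithinAt) (fun r hr => ?_) hs ht
  have h1 := hv.norm_sub_le (φ x r) 0
  rw [sub_zero] at h1
  have h2 := hφ.norm_le hv hx hr
  have h3 := mul_le_mul_of_nonneg_left h2 K.coe_nonneg
  linarith [norm_le_norm_sub_add (v (φ x r)) (v 0)]

/-- A solution on `(a, b]` with a right limit `u` at `a` is given by the flow. -/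
theorem eq_of_tendsto (hφ : IsLocalFlow v φ) (hv : LipschitzWith K v) {z : ℝ → E} {u : E}
    {a b : ℝ} (hab' : b ≤ a + 2)
    (hz : ∀ t ∈ Ioo a b, HasDerivAt z (v (z t)) t)
    (hzb : ContinuousWithinAt z (Iic b) b) (hza : Tendsto z (𝓝[>] a) (𝓝 u)) :
    ∀ t ∈ Ioc a b, z t = φ u (t - a) := by
  intro t ht
  have hψ : ∀ s ∈ Icc a b, HasDerivAt (fun s => φ u (s - a)) (v (φ u (s - a))) s := fun s hs => by
    have := hφ.hasDerivAt u (s - a) ⟨by linarith [hs.1], by linarith [hs.2]⟩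
    exact this.comp_sub_const s a
  have hzc : ∀ s ∈ Ioc a b, ContinuousWithinAt z (Iic b) s := fun s hs => by
    rcases hs.2.lt_or_eq with h | rfl
    · exact (hz s ⟨hs.1, h⟩).continuousAt.continuousWithinAt
    · exact hzb
  -- Grönwall starts at s > a, because z a is the value before the impulse and not u; then s tends
  -- to a from the right.
  have key : ∀ s ∈ Ioo a t, ‖z t - φ u (t - a)‖ ≤
      ‖z s - φ u (s - a)‖ * Real.exp (K * (t - a)) := by
    intro s hs
    have h := dist_le_of_trajectories_ODE (v := fun _ => v) (K := K) (f := z)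
      (g := fun s => φ u (s - a)) (a := s) (b := t) (fun _ => hv)
      (fun r hr => (hzc r ⟨hs.1.trans_le hr.1, hr.2.trans ht.2⟩).mono
        fun q hq => hq.2.trans ht.2)
      (fun r hr => (hz r ⟨hs.1.trans_le hr.1, hr.2.trans_le ht.2⟩).hasDerivWithinAt)
      (fun r hr => (hψ r ⟨hs.1.le.trans hr.1, hr.2.trans ht.2⟩).continuousAt.continuousWithinAt)
      (fun r hr => (hψ r ⟨hs.1.le.trans hr.1, hr.2.le.trans ht.2⟩).hasDerivWithinAt)
      le_rfl t ⟨hs.2.le, le_rfl⟩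
    rw [dist_eq_norm, dist_eq_norm] at h
    refine h.trans ?_
    gcongr
    exact hs.1.le
  have hlim : Tendsto (fun s => ‖z s - φ u (s - a)‖ * Real.exp (K * (t - a))) (𝓝[>] a) (𝓝 0) := by
    have h1 : Tendsto (fun s => φ u (s - a)) (𝓝[>] a) (𝓝 u) := by
      have := (hψ a ⟨le_rfl, ht.1.le.trans ht.2⟩).continuousAt.tendsto
      simp only [sub_self, hφ.zero] at this
      exact this.mono_left nhdsWithin_le_nhds
    simpa using ((hza.sub h1).norm).mul_const (Real.exp (K * (t - a)))
  have h0 := ge_of_tendsto hlim (Filter.eventually_of_mem (Ioo_mem_nhdsGT ht.1) key)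
  exact sub_eq_zero.1 (norm_le_zero_iff.1 h0)

end IsLocalFlow

end Flow

/-! ### Nonautonomous contractions -/

section Evolution

variable {X E : Type*} (h : X → X) (G : X → E → E)

/-- The composition of the `k` maps `G (h^[k - 1] κ) ∘ ⋯ ∘ G (h κ) ∘ G κ`. -/
def evolution : ℕ → X → E → E
  | 0, _, u => u
  | k + 1, κ, u => evolution k (h κ) (G κ u)

variable {h G}

/-- The recursive definition peels off the first map; orbits are extended by the last one. -/
theorem evolution_succ (k : ℕ) (κ : X) (u : E) :
    evolution h G (k + 1) κ u = G (h^[k] κ) (evolution h G k κ u) := by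
  induction k generalizing κ u with
  | zero => rfl
  | succ k ih => rw [evolution, ih, Function.iterate_succ_apply]; rfl

theorem eq_evolution {κ : X} {u : ℕ → E} (hu : ∀ k, u (k + 1) = G (h^[k] κ) (u k)) (k : ℕ) :
    u k = evolution h G k κ (u 0) := by
  induction k with
  | zero => rfl
  | succ k ih => rw [evolution_succ, ← ih, hu]

theorem eq_evolution_int {κ : ℤ → X} (hκ : ∀ i, κ (i + 1) = h (κ i)) {u : ℤ → E}
    (hu : ∀ i, u (i + 1) = G (κ i) (u i)) (i : ℤ) (k : ℕ) :
    u (i + k) = evolution h G k (κ i) (u i) := by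
  induction k generalizing i with
  | zero => simp [evolution]
  | succ k ih =>
    rw [evolution, ← hκ, ← hu, ← ih (i + 1)]
    congr 1
    push_cast
    ring

variable [NormedAddCommGroup E] {C r : ℝ}

/-- Exponential contraction of a family of compositions. -/
structure IsContractingEvolution (h : X → X) (G : X → E → E) (C r : ℝ) : Prop where
  nonneg : 0 ≤ C
  rate_nonneg : 0 ≤ r
  rate_lt_one : r < 1
  norm_sub_le : ∀ k κ u u', ‖evolution h G k κ u - evolution h G k κ u'‖ ≤ C * r ^ k * ‖u - u'‖

namespace IsContractingEvolution

/-- Approximate orbits stay near the exact orbits. -/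
theorem norm_sub_evolution_le (hG : IsContractingEvolution h G C r) {e : ℝ} (he : 0 ≤ e) {n : ℕ}
    {κ : X} {y : ℕ → E} (hy : ∀ i < n, ‖y (i + 1) - G (h^[i] κ) (y i)‖ ≤ e) :
    ‖y n - evolution h G n κ (y 0)‖ ≤ C * e / (1 - r) := by
  have hr : 0 < 1 - r := sub_pos.2 hG.rate_lt_one
  -- An error followed by j further maps has shrunk to at most C e r^j. The induction splits off the
  -- first step, whose error passes through all the remaining maps.
  suffices H : ‖y n - evolution h G n κ (y 0)‖ ≤ ∑ j ∈ Finset.range n, C * e * r ^ j by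
    refine H.trans ?_
    rw [← Finset.mul_sum, div_eq_mul_inv]
    refine mul_le_mul_of_nonneg_left ?_ (mul_nonneg hG.nonneg he)
    rw [← tsum_geometric_of_lt_one hG.rate_nonneg hG.rate_lt_one]
    exact (summable_geometric_of_lt_one hG.rate_nonneg hG.rate_lt_one).sum_le_tsum _
      fun i _ => pow_nonneg hG.rate_nonneg i
  clear hr
  induction n generalizing κ y with
  | zero => simp [evolution]
  | succ n ih =>
    have h1 := ih (κ := h κ) (y := fun i => y (i + 1))
      fun i hi => by simpa using hy (i + 1) (by lia)
    have h2 := hG.norm_sub_le n (h κ) (y 1) (G κ (y 0))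
    have h3 : ‖y 1 - G κ (y 0)‖ ≤ e := hy 0 (by lia)
    have h4 : C * r ^ n * ‖y 1 - G κ (y 0)‖ ≤ C * r ^ n * e :=
      mul_le_mul_of_nonneg_left h3 (mul_nonneg hG.nonneg (pow_nonneg hG.rate_nonneg n))
    have h5 := norm_sub_le_norm_sub_add_norm_sub (y (n + 1)) (evolution h G n (h κ) (y 1))
      (evolution h G (n + 1) κ (y 0))
    rw [Finset.sum_range_succ]
    simp only [zero_add] at h1
    rw [evolution] at h5 ⊢
    linarith

/-- The distance of an orbit to an approximate orbit. -/
theorem norm_sub_le_of_approx (hG : IsContractingEvolution h G C r) {e : ℝ} (he : 0 ≤ e) {n : ℕ}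
    {κ : X} {y : ℕ → E} (hy : ∀ i < n, ‖y (i + 1) - G (h^[i] κ) (y i)‖ ≤ e) (x : E) :
    ‖evolution h G n κ x - y n‖ ≤ C * r ^ n * ‖x - y 0‖ + C * e / (1 - r) := by
  have h1 := hG.norm_sub_evolution_le he hy
  have h2 := hG.norm_sub_le n κ x (y 0)
  rw [norm_sub_rev] at h1
  exact (norm_sub_le_norm_sub_add_norm_sub _ _ _).trans (add_le_add h2 h1)

/-- The constant sequence 0 is an approximate orbit with error e. -/
theorem norm_evolution_le (hG : IsContractingEvolution h G C r) {e : ℝ} (he : ∀ κ, ‖G κ 0‖ ≤ e)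
    (n : ℕ) (κ : X) (x : E) :
    ‖evolution h G n κ x‖ ≤ C * r ^ n * ‖x‖ + C * e / (1 - r) := by
  simpa using hG.norm_sub_le_of_approx (y := fun _ => 0) (n := n) (κ := κ)
    ((norm_nonneg _).trans (he κ)) (fun i _ => by simpa using he _) x

theorem tendsto_const_mul (hG : IsContractingEvolution h G C r) (M : ℝ) :
    Tendsto (fun n : ℕ => C * r ^ n * M) atTop (𝓝 0) := by
  simpa using ((tendsto_pow_atTop_nhds_zero_of_lt_one hG.rate_nonneg
    hG.rate_lt_one).const_mul C).mul_const M

theorem continuous (hG : IsContractingEvolution h G C r) (κ : X) : Continuous (G κ) := by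
  refine (LipschitzWith.of_dist_le_mul (K := (C * r).toNNReal) fun x y => ?_).continuous
  rw [Real.coe_toNNReal _ (mul_nonneg hG.nonneg hG.rate_nonneg), dist_eq_norm, dist_eq_norm]
  simpa [evolution] using hG.norm_sub_le 1 κ x y

/-- Bounded orbits on the whole axis are unique. -/
theorem eq_of_bounded (hG : IsContractingEvolution h G C r) {κ : ℤ → X}
    (hκ : ∀ i, κ (i + 1) = h (κ i)) {u u' : ℤ → E} (hu : ∀ i, u (i + 1) = G (κ i) (u i))
    (hu' : ∀ i, u' (i + 1) = G (κ i) (u' i)) {M : ℝ} (hM : ∀ i, ‖u i‖ ≤ M)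
    (hM' : ∀ i, ‖u' i‖ ≤ M) (i : ℤ) : u i = u' i := by
  have key : ∀ k : ℕ, ‖u i - u' i‖ ≤ C * r ^ k * (M + M) := fun k => by
    have h1 := hG.norm_sub_le k (κ (i - k)) (u (i - k)) (u' (i - k))
    rw [← eq_evolution_int hκ hu, ← eq_evolution_int hκ hu', sub_add_cancel] at h1
    refine h1.trans (mul_le_mul_of_nonneg_left ?_
      (mul_nonneg hG.nonneg (pow_nonneg hG.rate_nonneg k)))
    exact (_root_.norm_sub_le _ _).trans (add_le_add (hM _) (hM' _))
  have := ge_of_tendsto' (hG.tendsto_const_mul (M + M)) key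
  exact sub_eq_zero.1 (norm_le_zero_iff.1 this)

/-- The a priori bound M enters only through the transient C r^k M, which vanishes as the start
moves back in time; the remaining bound is common to all bounded orbits. -/
theorem norm_le_of_bounded (hG : IsContractingEvolution h G C r) {e : ℝ} (he : ∀ κ, ‖G κ 0‖ ≤ e)
    {κ : ℤ → X} (hκ : ∀ i, κ (i + 1) = h (κ i)) {u : ℤ → E}
    (hu : ∀ i, u (i + 1) = G (κ i) (u i)) {M : ℝ} (hM : ∀ i, ‖u i‖ ≤ M) (i : ℤ) :
    ‖u i‖ ≤ C * e / (1 - r) := by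
  have key : ∀ k : ℕ, ‖u i‖ ≤ C * r ^ k * M + C * e / (1 - r) := fun k => by
    have h1 := hG.norm_evolution_le he k (κ (i - k)) (u (i - k))
    rw [← eq_evolution_int hκ hu, sub_add_cancel] at h1
    refine h1.trans (add_le_add_left (mul_le_mul_of_nonneg_left (hM _)
      (mul_nonneg hG.nonneg (pow_nonneg hG.rate_nonneg k))) _)
  simpa using ge_of_tendsto' ((hG.tendsto_const_mul M).add_const (C * e / (1 - r))) key

/-- Existence of a bounded orbit on the whole axis. -/
theorem exists_bounded [CompleteSpace E] (hG : IsContractingEvolution h G C r) {e : ℝ}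
    (he : ∀ κ, ‖G κ 0‖ ≤ e) {κ : ℤ → X} (hκ : ∀ i, κ (i + 1) = h (κ i)) :
    ∃ u : ℤ → E, (∀ i, u (i + 1) = G (κ i) (u i)) ∧ ∀ i, ‖u i‖ ≤ C * e / (1 - r) := by
  -- Pull-back: the state at i of the orbit that starts from 0 at i - k. Passing from k to k + 1
  -- replaces the start 0 by an image G 0 under the same k maps, a change of at most C e r^k.
  let y : ℤ → ℕ → E := fun i k => evolution h G k (κ (i - k)) 0
  have hy : ∀ i, CauchySeq (y i) := fun i => by
    refine cauchySeq_of_le_geometric r (C * e) hG.rate_lt_one fun k => ?_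
    have h1 : y i (k + 1) = evolution h G k (κ (i - k)) (G (κ (i - (k + 1 : ℕ))) 0) := by
      simp only [y, evolution]
      rw [← hκ]
      congr 2
      push_cast
      ring
    rw [h1, dist_eq_norm, norm_sub_rev]
    refine (hG.norm_sub_le _ _ _ _).trans ?_
    rw [sub_zero, mul_right_comm]
    gcongr
    · exact pow_nonneg hG.rate_nonneg k
    · exact hG.nonneg
    · exact he _
  choose u hu using fun i => cauchySeq_tendsto_of_complete (hy i)
  refine ⟨u, fun i => ?_, fun i => ?_⟩
  · have h1 : Tendsto (fun k => y (i + 1) (k + 1)) atTop (𝓝 (u (i + 1))) :=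
      (hu (i + 1)).comp (tendsto_add_atTop_nat 1)
    have h2 : Tendsto (fun k => G (κ i) (y i k)) atTop (𝓝 (G (κ i) (u i))) :=
      ((hG.continuous (κ i)).tendsto _).comp (hu i)
    refine tendsto_nhds_unique h1 (h2.congr fun k => ?_)
    have hiter : ∀ (k : ℕ) (j : ℤ), h^[k] (κ j) = κ (j + k) := fun k => by
      induction k with
      | zero => simp
      | succ k ih =>
        intro j
        rw [Function.iterate_succ_apply, ← hκ, ih]
        congr 1
        push_cast
        ring
    simp only [y]
    rw [show i + 1 - ((k + 1 : ℕ) : ℤ) = i - k by push_cast; ring, evolution_succ, hiter,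
      sub_add_cancel]
  · refine le_of_tendsto' (hu i).norm fun k => ?_
    have := hG.norm_evolution_le he k (κ (i - k)) 0
    simpa using this

end IsContractingEvolution

end Evolution

/-! ### Systems that are conjugate to the shift -/

theorem shiftMap_iterate (s : ℕ → Fin 2) (k i : ℕ) : shiftMap^[k] s i = s (k + i) := by
  induction k generalizing s with
  | zero => simp
  | succ k ih => rw [Function.iterate_succ_apply, ih, shiftMap]; congr 1; ring

theorem continuous_shiftMap : Continuous shiftMap :=
  continuous_pi fun i => continuous_apply (i + 1)

/-- A binary sequence that contains all finite words. -/
def universalCode (p : ℕ) : Fin 2 :=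
  if (Nat.log 2 p).testBit (p - 2 ^ Nat.log 2 p) then 1 else 0

theorem exists_universalCode_eq (w : ℕ → Fin 2) (n : ℕ) :
    ∃ m, ∀ i < n, universalCode (m + i) = w i := by
  -- The universal code carries the binary digits of N at the places from 2^N on. The digits of N
  -- are taken from w, and the additional digit 1 at place n forces N ≥ 2^n, so that the word fits
  -- before 2^(N+1).
  let b : Fin (n + 1) → Bool := fun i => if (i : ℕ) < n then w i = 1 else true
  let N := Nat.ofBits b
  have hN : n < 2 ^ N := by
    have h1 : N.testBit n = true := by
      simp [N, b]
    have h2 := Nat.ge_two_pow_of_testBit h1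
    exact (Nat.lt_two_pow_self (n := n)).trans_le (h2.trans (Nat.lt_two_pow_self).le)
  refine ⟨2 ^ N, fun i hi => ?_⟩
  have hlog : Nat.log 2 (2 ^ N + i) = N :=
    Nat.log_eq_of_pow_le_of_lt_pow (by lia) (by rw [pow_succ]; lia)
  have hb : N.testBit i = decide (w i = 1) := by
    have := Nat.testBit_ofBits_lt b i (hi.trans n.lt_succ_self)
    simpa [N, b, hi] using this
  rw [universalCode, hlog, Nat.add_sub_cancel_left, hb]
  rcases Fin.exists_fin_two.1 ⟨w i, rfl⟩ with h | h <;> simp [h]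

section Conjugate

variable {Λ : Set ℝ} {h : Λ → Λ} {S : Λ ≃ₜ (ℕ → Fin 2)}

theorem iterate_conj (hS : ∀ x, S (h x) = shiftMap (S x)) (x : Λ) (k i : ℕ) :
    S (h^[k] x) i = S x (k + i) := by
  rw [← shiftMap_iterate (S x)]
  induction k generalizing x with
  | zero => rfl
  | succ k ih => rw [Function.iterate_succ_apply, ih, hS, Function.iterate_succ_apply]

theorem continuous_of_conj (hS : ∀ x, S (h x) = shiftMap (S x)) : Continuous h := by
  have : h = fun x => S.symm (shiftMap (S x)) := by
    ext x
    rw [← hS, S.symm_apply_apply]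
  rw [this]
  exact S.symm.continuous.comp (continuous_shiftMap.comp S.continuous)

/-- Compactness, inherited from the Cantor space, is the source of the uniform constants for codes
and gaps below. -/
theorem compactSpace_of_code (S : Λ ≃ₜ (ℕ → Fin 2)) : CompactSpace Λ :=
  S.symm.compactSpace

/-- Every two-sided code belongs to a two-sided orbit. -/
theorem exists_orbit_of_code (hS : ∀ x, S (h x) = shiftMap (S x)) (a : ℤ → Fin 2) :
    ∃ κ : ℤ → Λ, (∀ i, κ (i + 1) = h (κ i)) ∧ ∀ (i : ℤ) (j : ℕ), S (κ i) j = a (i + j) := by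
  refine ⟨fun i => S.symm fun j => a (i + j), fun i => S.injective ?_, fun i j => ?_⟩
  · rw [hS]
    ext j : 1
    simp only [S.apply_symm_apply, shiftMap]
    congr 1
    push_cast
    ring
  · simp only [S.apply_symm_apply]

theorem exists_orbit (hS : ∀ x, S (h x) = shiftMap (S x)) (x : Λ) :
    ∃ κ : ℤ → Λ, (∀ i, κ (i + 1) = h (κ i)) ∧ κ 0 = x := by
  -- `Int.toNat` sends negative places to 0, so the code is continued to the left by its first
  -- symbol.
  obtain ⟨κ, hκ, hc⟩ := exists_orbit_of_code hS fun i => S x i.toNat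
  refine ⟨κ, hκ, S.injective ?_⟩
  ext j : 1
  simp [hc]

/-- Periodic orbits approximate every orbit. -/
theorem exists_periodic_orbit (hS : ∀ x, S (h x) = shiftMap (S x)) (x : Λ) (n : ℕ) :
    ∃ κ : ℤ → Λ, (∀ i, κ (i + 1) = h (κ i)) ∧ (∀ i, κ (i + (n + 1 : ℕ)) = κ i) ∧
      ∀ i ≤ n, S (κ 0) i = S x i := by
  -- The first n + 1 symbols are repeated in both directions; the remainder is nonnegative also for
  -- negative i.
  obtain ⟨κ, hκ, hc⟩ := exists_orbit_of_code hS fun i => S x (i % (n + 1 : ℕ)).toNat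
  refine ⟨κ, hκ, fun i => S.injective ?_, fun i hi => ?_⟩
  · ext j : 1
    rw [hc, hc, add_right_comm, Int.add_emod_right]
  · rw [hc, zero_add, Int.emod_eq_of_lt (by lia) (by lia), Int.toNat_natCast]

theorem exists_dense_orbit (hS : ∀ x, S (h x) = shiftMap (S x)) :
    ∃ x : Λ, ∀ (y : Λ) (n : ℕ), ∃ m : ℕ, ∀ i < n, S (h^[m] x) i = S y i := by
  refine ⟨S.symm universalCode, fun y n => ?_⟩
  obtain ⟨m, hm⟩ := exists_universalCode_eq (S y) n
  exact ⟨m, fun i hi => by rw [iterate_conj hS, S.apply_symm_apply, hm i hi]⟩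

/-- Points whose codes agree in the beginning are near to each other. -/
theorem exists_code_modulus (S : Λ ≃ₜ (ℕ → Fin 2)) {δ : ℝ} (hδ : 0 < δ) :
    ∃ r : ℕ, ∀ x y : Λ, (∀ i < r, S x i = S y i) → |(x : ℝ) - y| < δ := by
  -- Compactness: along a subsequence of counterexamples the x converge, the codes of the y then
  -- have the same coordinatewise limit, and continuity of the inverse of `S` brings the y to the
  -- same point.
  by_contra! H
  choose x y hxy hd using H
  have : CompactSpace Λ := compactSpace_of_code S
  obtain ⟨a, ψ, hψ, hxa⟩ := CompactSpace.tendsto_subseq x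
  have hSx : Tendsto (fun n => S (x (ψ n))) atTop (𝓝 (S a)) := (S.continuous.tendsto a).comp hxa
  have hSy : Tendsto (fun n => S (y (ψ n))) atTop (𝓝 (S a)) := by
    rw [tendsto_pi_nhds] at hSx ⊢
    intro i
    refine (hSx i).congr' ?_
    filter_upwards [eventually_gt_atTop i] with n hn
    exact hxy (ψ n) i (hn.trans_le hψ.le_apply)
  have hya : Tendsto (fun n => y (ψ n)) atTop (𝓝 a) := by
    simpa [Function.comp_def] using (S.symm.continuous.tendsto (S a)).comp hSy
  have h1 : Tendsto (fun n => |(x (ψ n) : ℝ) - y (ψ n)|) atTop (𝓝 |(a : ℝ) - a|) :=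
    (((continuous_subtype_val.tendsto a).comp hxa).sub
      ((continuous_subtype_val.tendsto a).comp hya)).abs
  rw [sub_self, abs_zero] at h1
  exact absurd (ge_of_tendsto' h1 fun n => hd (ψ n)) (not_le.2 hδ)

/-- Points whose codes differ in the first place are far from each other. -/
theorem exists_code_separation (S : Λ ≃ₜ (ℕ → Fin 2)) :
    ∃ c > 0, ∀ x y : Λ, |(x : ℝ) - y| < c → S x 0 = S y 0 := by
  have : CompactSpace Λ := compactSpace_of_code S
  have hc : Continuous fun x : Λ => ((S x 0 : ℕ) : ℝ) :=
    (continuous_of_discreteTopology (f := fun i : Fin 2 => ((i : ℕ) : ℝ))).comp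
      ((continuous_apply 0).comp S.continuous)
  obtain ⟨c, hc0, hc⟩ := Metric.uniformContinuous_iff.1
    (CompactSpace.uniformContinuous_of_continuous hc) 1 one_pos
  refine ⟨c, hc0, fun x y hxy => ?_⟩
  have := hc (a := x) (b := y) hxy
  rw [Real.dist_eq] at this
  have h2 : |((S x 0 : ℕ) : ℤ) - ((S y 0 : ℕ) : ℤ)| < 1 := by exact_mod_cast this
  rw [Int.abs_lt_one_iff] at h2
  exact Fin.ext (by lia)

/-- Near every point there is a point whose orbit separates from the given one, as late as one
wishes. -/
theorem exists_separating_point (hS : ∀ x, S (h x) = shiftMap (S x)) {c : ℝ} (hc : 0 < c)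
    (hsep : ∀ x y : Λ, |(x : ℝ) - y| < c → S x 0 = S y 0) (x : Λ) {δ : ℝ} (hδ : 0 < δ) (K : ℕ) :
    ∃ y : Λ, |(x : ℝ) - y| < δ ∧ ∃ k ≥ K, c ≤ |(h^[k] x : ℝ) - h^[k] y| ∧
      ∀ j < k, |(h^[j] x : ℝ) - h^[j] y| < c := by
  obtain ⟨r₁, hr₁⟩ := exists_code_modulus S hδ
  obtain ⟨r₂, hr₂⟩ := exists_code_modulus S hc
  let m := r₁ + r₂ + K
  -- Only the symbol at place m is flipped. The summand r₁ in m puts y within δ of x, and r₂ + K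
  -- keeps the iterates closer than c before time K. At time m the flipped symbol comes first and
  -- separates the orbits, so a least separation time exists.
  let y : Λ := S.symm fun i => if i = m then S x i + 1 else S x i
  have hy : ∀ i, S y i = if i = m then S x i + 1 else S x i := fun i => by
    simp only [y, S.apply_symm_apply]
  have hy' : ∀ i < m, S x i = S y i := fun i hi => by rw [hy, if_neg hi.ne]
  have hex : ∃ k, c ≤ |(h^[k] x : ℝ) - h^[k] y| := by
    refine ⟨m, not_lt.1 fun hlt => ?_⟩
    have := hsep _ _ hlt
    rw [iterate_conj hS, iterate_conj hS, hy, if_pos (add_zero m)] at this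
    simp at this
  classical
  refine ⟨y, hr₁ _ _ fun i hi => hy' i (by lia), Nat.find hex, ?_, Nat.find_spec hex,
    fun j hj => not_le.1 (Nat.find_min hex hj)⟩
  by_contra! hlt
  refine absurd (Nat.find_spec hex) (not_le.2 (hr₂ _ _ fun i hi => ?_))
  rw [iterate_conj hS, iterate_conj hS]
  exact hy' _ (by lia)

/-- Orbits whose codes agree in the beginning are near to each other for a long time. -/
theorem exists_code_modulus_iterate (hS : ∀ x, S (h x) = shiftMap (S x)) {δ : ℝ} (hδ : 0 < δ)
    (n : ℕ) : ∃ r : ℕ, ∀ x y : Λ, (∀ i < r, S x i = S y i) →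
      ∀ k ≤ n, |(h^[k] x : ℝ) - h^[k] y| < δ := by
  obtain ⟨r, hr⟩ := exists_code_modulus S hδ
  refine ⟨n + r, fun x y hxy k hk => hr _ _ fun i hi => ?_⟩
  rw [iterate_conj hS, iterate_conj hS]
  exact hxy _ (by lia)

/-- The distances between consecutive moments of impulses are bounded from below. -/
theorem exists_gap (hΛ : Λ ⊆ Icc 0 1) (hS : ∀ x, S (h x) = shiftMap (S x))
    (hdist : ∀ x : Λ, ¬ ((x : ℝ) = 1 ∧ (h x : ℝ) = 0)) :
    ∃ g > 0, ∀ x : Λ, g ≤ 1 + (h x : ℝ) - x := by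
  have : CompactSpace Λ := compactSpace_of_code S
  have : Nonempty Λ := ⟨S.symm fun _ => 0⟩
  have hc : Continuous fun x : Λ => 1 + (h x : ℝ) - x :=
    (continuous_const.add (continuous_subtype_val.comp (continuous_of_conj hS))).sub
      continuous_subtype_val
  -- The gap attains its minimum, which is nonnegative and could vanish only for x₀ = 1 and h x₀ =
  -- 0.
  obtain ⟨x₀, -, hx₀⟩ := isCompact_univ.exists_isMinOn univ_nonempty hc.continuousOn
  refine ⟨_, ?_, fun x => hx₀ (mem_univ x)⟩
  have h1 := (hΛ x₀.2).2
  have h2 := (hΛ (h x₀).2).1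
  refine lt_of_le_of_ne (by linarith) fun h0 => hdist x₀ ⟨by linarith, by linarith⟩

end Conjugate

/-! ### Moments of impulses in forward time -/

section Moments

variable {Λ : Set ℝ} {h : Λ → Λ}

/-- The moments of impulses in forward time that belong to the initial moment `x`. -/
def moment (h : Λ → Λ) (x : Λ) (k : ℕ) : ℝ := k + (h^[k] x : ℝ)

/-- The distance of the first two moments of impulses. -/
def momentGap (h : Λ → Λ) (x : Λ) : ℝ := 1 + (h x : ℝ) - x

@[simp]
theorem moment_zero (x : Λ) : moment h x 0 = x := by simp [moment]

theorem moment_succ (x : Λ) (k : ℕ) : moment h x (k + 1) = 1 + moment h (h x) k := by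
  simp only [moment, Function.iterate_succ_apply]
  push_cast
  ring

theorem moment_add (x : Λ) (m k : ℕ) : moment h x (m + k) = m + moment h (h^[m] x) k := by
  simp only [moment, ← Function.iterate_add_apply, add_comm k m]
  push_cast
  ring

theorem moment_succ_eq_add_gap (x : Λ) (k : ℕ) :
    moment h x (k + 1) = moment h x k + momentGap h (h^[k] x) := by
  simp only [moment, momentGap, Function.iterate_succ_apply']
  push_cast
  ring

theorem le_moment (hΛ : Λ ⊆ Icc 0 1) (x : Λ) (k : ℕ) : (k : ℝ) ≤ moment h x k := by
  have := (hΛ (h^[k] x).2).1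
  simp only [moment]
  linarith

theorem moment_le (hΛ : Λ ⊆ Icc 0 1) (x : Λ) (k : ℕ) : moment h x k ≤ k + 1 := by
  have := (hΛ (h^[k] x).2).2
  simp only [moment]
  linarith

theorem moment_le_succ (hΛ : Λ ⊆ Icc 0 1) (x : Λ) (k : ℕ) : moment h x k ≤ moment h x (k + 1) := by
  have h1 := moment_le (h := h) hΛ x k
  have h2 := le_moment (h := h) hΛ x (k + 1)
  push_cast at h2
  linarith

/-- This is why a flow on [0, 2] spans every interval between consecutive impulses. -/
theorem momentGap_mem (hΛ : Λ ⊆ Icc 0 1) (x : Λ) : momentGap h x ∈ Icc (0 : ℝ) 2 := by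
  have h1 := hΛ x.2
  have h2 := hΛ (h x).2
  constructor <;> simp only [momentGap] <;> linarith [h1.1, h1.2, h2.1, h2.2]

end Moments

/-! ### Exponential contraction -/

/-- Grönwall's inequality in integral form. -/
theorem add_mul_integral_le_mul_exp {y : ℝ → ℝ} (hy : Continuous y) (hy0 : ∀ t, 0 ≤ y t)
    {G c l : ℝ} (hG : 0 ≤ G) (hc : 0 ≤ c)
    (hle : ∀ t ∈ Icc 0 l, y t ≤ G + c * ∫ s in (0 : ℝ)..t, y s) {t : ℝ} (ht : t ∈ Icc 0 l) :
    G + c * ∫ s in (0 : ℝ)..t, y s ≤ G * Real.exp (c * t) := by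
  -- The differential form of Grönwall's inequality is applied to the right-hand side, whose
  -- derivative c y is at most c times itself.
  have hder : ∀ t, HasDerivAt (fun t => G + c * ∫ s in (0 : ℝ)..t, y s) (c * y t) t := fun t =>
    ((hy.integral_hasStrictDerivAt 0 t).hasDerivAt.const_mul c).const_add G
  have hnn : ∀ t ∈ Icc 0 l, 0 ≤ G + c * ∫ s in (0 : ℝ)..t, y s := fun t ht =>
    (hy0 t).trans (hle t ht)
  have := norm_le_gronwallBound_of_norm_deriv_right_le (δ := G) (K := c) (ε := 0) (a := 0) (b := l)
    (fun t _ => (hder t).continuousAt.continuousWithinAt) (fun t _ => (hder t).hasDerivWithinAt)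
    (by simp [abs_of_nonneg hG]) (fun t ht => ?_) t ht
  · rw [gronwallBound_ε0, sub_zero] at this
    exact (le_abs_self _).trans this
  · have ht' : t ∈ Icc 0 l := ⟨ht.1, ht.2.le⟩
    rw [Real.norm_of_nonneg (mul_nonneg hc (hy0 t)), Real.norm_of_nonneg (hnn t ht'), add_zero]
    exact mul_le_mul_of_nonneg_left (hle t ht') hc

section Contraction

open scoped NNReal

variable {E : Type*} [NormedAddCommGroup E] [NormedSpace ℝ E]
  {Λ : Set ℝ} {h : Λ → Λ} {A B : E →L[ℝ] E} {f W : E → E} {φ : E → ℝ → E} {L N ω G : ℝ}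

/-- Exponential decay of the transition operators from points of the first interval between
impulses. -/
def HasTransitionBound (h : Λ → Λ) (A B : E →L[ℝ] E) (N ω : ℝ) : Prop :=
  ∀ (x : Λ) (k : ℕ), ∀ s ∈ Icc (moment h x 0) (moment h x 1),
    ∀ t ∈ Icc (moment h x k) (moment h x (k + 1)), s ≤ t →
      ‖NormedSpace.exp ((t - s) • A) * (1 + B) ^ k‖ ≤ N * Real.exp (-ω * (t - s))

/-- `G` bounds the norm of `w` that is adapted to the decay of the linear system after the
moment `x`. -/
def AdaptedNormLE (h : Λ → Λ) (A B : E →L[ℝ] E) (ω : ℝ) (x : Λ) (w : E) (G : ℝ) : Prop :=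
  ∀ (k : ℕ), ∀ t ∈ Icc (moment h x k) (moment h x (k + 1)),
    ‖(NormedSpace.exp ((t - x) • A) * (1 + B) ^ k) w‖ ≤ G * Real.exp (-ω * (t - x))

/-- The state after an impulse as a function of the state after the previous impulse. -/
def postMap (h : Λ → Λ) (B : E →L[ℝ] E) (W : E → E) (φ : E → ℝ → E) (x : Λ) (u : E) : E :=
  φ u (momentGap h x) + (B (φ u (momentGap h x)) + W (φ u (momentGap h x)))

/-- Evaluation at k = 0, t = x. With the next lemma, the adapted norm lies between ‖w‖ and N‖w‖, so
a conversion is needed only at the two ends of a long composition. -/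
theorem AdaptedNormLE.norm_le (hΛ : Λ ⊆ Icc 0 1) {x : Λ} {w : E}
    (hw : AdaptedNormLE h A B ω x w G) : ‖w‖ ≤ G := by
  have := hw 0 x ⟨by simp, by simpa using moment_le_succ (h := h) hΛ x 0⟩
  simpa using this

theorem HasTransitionBound.adaptedNormLE (hΛ : Λ ⊆ Icc 0 1) (hT : HasTransitionBound h A B N ω)
    (x : Λ) (w : E) : AdaptedNormLE h A B ω x w (N * ‖w‖) := by
  intro k t ht
  have hk : (x : ℝ) ≤ moment h x k := by
    cases k with
    | zero => simp
    | succ k =>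
      have h1 := le_moment (h := h) hΛ x (k + 1)
      have h2 := (hΛ x.2).2
      push_cast at h1
      linarith [k.cast_nonneg (α := ℝ)]
  have h1 := hT x k x ⟨by simp, by simpa using moment_le_succ (h := h) hΛ x 0⟩ t ht (hk.trans ht.1)
  calc _ ≤ _ := ContinuousLinearMap.le_opNorm _ w
    _ ≤ N * Real.exp (-ω * (t - x)) * ‖w‖ := by gcongr
    _ = _ := by ring

variable [CompleteSpace E]

/-- The growth of the adapted norm of the difference of two solutions between impulses. -/
theorem AdaptedNormLE.flow (hΛ : Λ ⊆ Icc 0 1) (hT : HasTransitionBound h A B N ω)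
    (hφ : IsLocalFlow (fun x => A x + f x) φ) (hAB : Commute A B) (hN : 0 ≤ N) (hL : 0 ≤ L)
    (hf : ∀ x y, ‖f x - f y‖ ≤ L * ‖x - y‖) (hG : 0 ≤ G) {x : Λ} {u u' : E}
    (hw : AdaptedNormLE h A B ω x (u - u') G) (k : ℕ) {t T : ℝ} (ht : t ∈ Icc 0 (momentGap h x))
    (hT' : T ∈ Icc (moment h x k) (moment h x (k + 1))) (htT : x + t ≤ T) :
    ‖(NormedSpace.exp ((T - x - t) • A) * (1 + B) ^ k) (φ u t - φ u' t)‖ ≤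
      G * Real.exp (N * L * t) * Real.exp (-ω * (T - x)) := by
  have hl := momentGap_mem (h := h) hΛ x
  set l := momentGap h x with hldef
  have hm1 : moment h x 1 = x + l := by simpa using moment_succ_eq_add_gap (h := h) x 0
  let w : ℝ → E := fun t => φ u t - φ u' t
  have hwc : ContinuousOn (fun s => Real.exp (ω * s) * ‖w s‖) (Icc 0 l) := by
    have := ((hφ.continuousOn u).sub (hφ.continuousOn u')).mono (Icc_subset_Icc_right hl.2)
    exact (by fun_prop : Continuous fun s : ℝ => Real.exp (ω * s)).continuousOn.mul this.norm
  let y : ℝ → ℝ := IccExtend hl.1 ((Icc 0 l).domRestrict fun s => Real.exp (ω * s) * ‖w s‖)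
  have hy : Continuous y := continuousOn_iff_continuous_domRestrict.1 hwc |>.Icc_extend'
  have hyeq : ∀ s ∈ Icc 0 l, y s = Real.exp (ω * s) * ‖w s‖ := fun s hs =>
    IccExtend_of_mem hl.1 _ hs
  have hy0 : ∀ s, 0 ≤ y s := fun s => by
    exact mul_nonneg (Real.exp_pos _).le (norm_nonneg _)
  have hI : ∀ t, HasDerivAt (fun t => ∫ s in (0 : ℝ)..t, y s) (y t) t := fun t =>
    (hy.integral_hasStrictDerivAt 0 t).hasDerivAt
  -- Variation of constants: when the linear evolution up to T is applied to w(s) and differentiated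
  -- in s, the terms with A cancel, since A commutes with the powers of 1 + B. Only the difference
  -- of the values of f remains, and its image is bounded by e^{-ω(T-x)} N L y(s).
  have main : ∀ (k : ℕ) (T : ℝ), T ∈ Icc (moment h x k) (moment h x (k + 1)) →
      ∀ t ∈ Icc 0 l, x + t ≤ T →
      ‖(NormedSpace.exp ((T - x - t) • A) * (1 + B) ^ k) (w t)‖ ≤
        Real.exp (-ω * (T - x)) * (G + N * L * ∫ s in (0 : ℝ)..t, y s) := by
    intro k T hT' t ht htT
    have hcomm : Commute A ((1 + B) ^ k) := ((Commute.one_right A).add_right hAB).pow_right k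
    have hder : ∀ s ∈ Icc 0 t, HasDerivAt
        (fun s => (NormedSpace.exp ((T - x - s) • A) * (1 + B) ^ k) (w s))
        ((NormedSpace.exp ((T - x - s) • A) * (1 + B) ^ k) (f (φ u s) - f (φ u' s))) s := by
      intro s hs
      have hs2 : s ∈ Icc (0 : ℝ) 2 := ⟨hs.1, hs.2.trans (ht.2.trans hl.2)⟩
      have h1 : HasDerivAt w _ s := (hφ.hasDerivAt u s hs2).sub (hφ.hasDerivAt u' s hs2)
      have h2 : HasDerivAt (fun s => NormedSpace.exp ((T - x - s) • A))
          (-(NormedSpace.exp ((T - x - s) • A) * A)) s := by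
        have h3 := (hasDerivAt_exp_smul_const (𝕂 := ℝ) A (T - x - s)).scomp s
          ((hasDerivAt_id s).const_sub (T - x))
        simpa [Function.comp_def] using h3
      have h4 := (h2.mul_const ((1 + B) ^ k)).clm_apply h1
      convert h4 using 1
      simp only [neg_mul, mul_assoc, hcomm.eq]
      simp only [w, ← mul_assoc, map_sub, map_add, neg_apply, mul_apply_eq_comp]
      abel
    refine image_norm_le_of_norm_deriv_right_le_deriv_boundary (a := 0) (b := t)
      (B := fun t => Real.exp (-ω * (T - x)) * (G + N * L * ∫ s in (0 : ℝ)..t, y s))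
      (fun s hs => (hder s hs).continuousAt.continuousWithinAt)
      (fun s hs => (hder s ⟨hs.1, hs.2.le⟩).hasDerivWithinAt) ?_
      (fun s => (((hI s).const_mul (N * L)).const_add G).const_mul _) (fun s hs => ?_)
      ⟨ht.1, le_rfl⟩
    · have := hw k T hT'
      simp only [sub_zero, w, hφ.zero, intervalIntegral.integral_same, mul_zero, add_zero]
      linarith
    · have hsl : s ∈ Icc 0 l := ⟨hs.1, hs.2.le.trans ht.2⟩
      have h1 := hT x k (x + s) ⟨by simpa using hs.1, by rw [hm1]; linarith [hsl.2]⟩ T hT'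
        (by linarith [hs.2])
      rw [← sub_sub] at h1
      have h2 := hf (φ u s) (φ u' s)
      calc _ ≤ _ := ContinuousLinearMap.le_opNorm _ _
        _ ≤ N * Real.exp (-ω * (T - x - s)) * (L * ‖w s‖) := by gcongr
        _ = _ := by
          rw [hyeq s hsl, show -ω * (T - x - s) = -ω * (T - x) + ω * s by ring, Real.exp_add]
          ring
  -- For k = 0 and T = x + t the operator is the identity, and `main` becomes an integral inequality
  -- for y itself. Its Grönwall bound is then inserted in `main` for general T.
  have hle : ∀ t ∈ Icc 0 l, y t ≤ G + N * L * ∫ s in (0 : ℝ)..t, y s := by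
    intro t ht
    have h1 := main 0 (x + t) ⟨by simpa using ht.1, by rw [zero_add, hm1]; linarith [ht.2]⟩ t ht
      le_rfl
    simp only [add_sub_cancel_left, sub_self, zero_smul, NormedSpace.exp_zero, pow_zero, mul_one,
      one_apply_eq_self] at h1
    rw [hyeq t ht]
    calc _ ≤ Real.exp (ω * t) * _ := mul_le_mul_of_nonneg_left h1 (Real.exp_pos _).le
      _ = _ := by rw [← mul_assoc, ← Real.exp_add]; simp
  have h1 := add_mul_integral_le_mul_exp hy hy0 hG (mul_nonneg hN hL) hle ht
  refine (main k T hT' t ht htT).trans ?_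
  rw [mul_comm]
  gcongr

/-- The growth of the adapted norm of the difference of two solutions from impulse to impulse. -/
theorem AdaptedNormLE.postMap (hΛ : Λ ⊆ Icc 0 1) (hT : HasTransitionBound h A B N ω)
    (hφ : IsLocalFlow (fun x => A x + f x) φ) (hAB : Commute A B) (hN : 0 ≤ N) (hL : 0 ≤ L)
    (hf : ∀ x y, ‖f x - f y‖ ≤ L * ‖x - y‖) (hW : ∀ x y, ‖W x - W y‖ ≤ L * ‖x - y‖)
    (hG : 0 ≤ G) {x : Λ} {u u' : E} (hw : AdaptedNormLE h A B ω x (u - u') G) :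
    AdaptedNormLE h A B ω (h x) (postMap h B W φ x u - postMap h B W φ x u')
      (G * ((1 + N * L) * Real.exp (-(ω - N * L) * momentGap h x))) := by
  have hl := momentGap_mem (h := h) hΛ x
  have hm1 : moment h x 1 = x + momentGap h x := by simpa using moment_succ_eq_add_gap (h := h) x 0
  have hhx : (h x : ℝ) = x + momentGap h x - 1 := by simp [momentGap]
  intro k t ht
  simp only [_root_.postMap]
  set l := momentGap h x with hldef
  set a := φ u l
  set b := φ u' l
  have hxt : (h x : ℝ) ≤ t := by
    refine le_trans ?_ ht.1
    rw [← moment_zero (h := h) (h x)]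
    exact monotone_nat_of_le_succ (fun k => moment_le_succ hΛ (h x) k) k.zero_le
  -- Moments counted from h x are one unit smaller than those counted from x, so t corresponds to t
  -- + 1. The linear part of the jump only raises the power of 1 + B, so it costs no factor N; only
  -- the difference of the values of W does.
  have h1 : ‖(NormedSpace.exp ((t - h x) • A) * (1 + B) ^ (k + 1)) (a - b)‖ ≤
      G * Real.exp (N * L * l) * (Real.exp (-ω * (t - h x)) * Real.exp (-ω * l)) := by
    have := hw.flow hΛ hT hφ hAB hN hL hf hG (k + 1) (t := l) (T := t + 1) ⟨hl.1, le_rfl⟩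
      (by rw [moment_succ, moment_succ]; constructor <;> linarith [ht.1, ht.2]) (by linarith)
    rwa [show t + 1 - x - l = t - h x by rw [hhx]; ring,
      show -ω * (t + 1 - x) = -ω * (t - h x) + -ω * l by rw [hhx]; ring, Real.exp_add] at this
  have h2 : ‖a - b‖ ≤ G * Real.exp (N * L * l) * Real.exp (-ω * l) := by
    have := hw.flow hΛ hT hφ hAB hN hL hf hG 0 (t := l) (T := x + l) ⟨hl.1, le_rfl⟩
      (by rw [zero_add, hm1]; exact ⟨by simpa using hl.1, le_rfl⟩) le_rfl
    simpa using this
  have h3 : ‖(NormedSpace.exp ((t - h x) • A) * (1 + B) ^ k) (W a - W b)‖ ≤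
      N * Real.exp (-ω * (t - h x)) * (L * ‖a - b‖) := by
    refine (ContinuousLinearMap.le_opNorm _ _).trans ?_
    gcongr
    · exact hT (h x) k (h x) ⟨by simp, by simpa using moment_le_succ (h := h) hΛ (h x) 0⟩ t ht hxt
    · exact hW a b
  have h4 : (NormedSpace.exp ((t - h x) • A) * (1 + B) ^ k)
      (a + (B a + W a) - (b + (B b + W b))) =
      (NormedSpace.exp ((t - h x) • A) * (1 + B) ^ (k + 1)) (a - b) +
      (NormedSpace.exp ((t - h x) • A) * (1 + B) ^ k) (W a - W b) := by
    rw [pow_succ, ← mul_assoc, mul_apply_eq_comp _ (1 + B), ← map_add]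
    congr 1
    simp only [add_apply, one_apply_eq_self, map_sub]
    abel
  rw [h4]
  refine (norm_add_le _ _).trans ((add_le_add h1 h3).trans ?_)
  calc _ ≤ G * Real.exp (N * L * l) * (Real.exp (-ω * (t - h x)) * Real.exp (-ω * l)) +
        N * Real.exp (-ω * (t - h x)) * (L * (G * Real.exp (N * L * l) * Real.exp (-ω * l))) := by
        gcongr
    _ = _ := by
      rw [show -(ω - N * L) * l = N * L * l + -ω * l by ring, Real.exp_add]
      ring

/-- The evolution from impulse to impulse is exponentially contracting. -/
theorem isContractingEvolution_postMap (hΛ : Λ ⊆ Icc 0 1) (hT : HasTransitionBound h A B N ω)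
    (hφ : IsLocalFlow (fun x => A x + f x) φ) (hAB : Commute A B) (hN : 0 ≤ N) (hL : 0 ≤ L)
    (hf : ∀ x y, ‖f x - f y‖ ≤ L * ‖x - y‖) (hW : ∀ x y, ‖W x - W y‖ ≤ L * ‖x - y‖)
    (hneg : -ω + N * L + Real.log (1 + N * L) < 0) :
    IsContractingEvolution h (postMap h B W φ) (N * Real.exp (ω - N * L))
      ((1 + N * L) * Real.exp (-(ω - N * L))) := by
  have hNL : 0 ≤ N * L := mul_nonneg hN hL
  have hb : 0 < ω - N * L := by linarith [Real.log_nonneg (by linarith : 1 ≤ 1 + N * L)]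
  -- The gaps in the exponent telescope to the elapsed time. This is at least k - 1, since moments
  -- deviate from integers by at most 1; the missing unit is the factor e^{ω-NL} of the constant.
  have key : ∀ (k : ℕ) (x : Λ) (u u' : E) (G : ℝ), 0 ≤ G → AdaptedNormLE h A B ω x (u - u') G →
      ‖evolution h (postMap h B W φ) k x u - evolution h (postMap h B W φ) k x u'‖ ≤
        G * (1 + N * L) ^ k * Real.exp (-(ω - N * L) * (moment h x k - x)) := by
    intro k
    induction k with
    | zero => intro x u u' G _ hw; simpa [evolution] using hw.norm_le hΛ
    | succ k ih =>
      intro x u u' G hG hw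
      have h1 := ih (h x) _ _ _ (by positivity) (hw.postMap hΛ hT hφ hAB hN hL hf hW hG)
      rw [evolution, evolution]
      refine h1.trans (le_of_eq ?_)
      rw [moment_succ, show -(ω - N * L) * (1 + moment h (h x) k - x) = -(ω - N * L) *
        momentGap h x + -(ω - N * L) * (moment h (h x) k - h x) by rw [momentGap]; ring,
        Real.exp_add]
      ring
  refine ⟨by positivity, by positivity, ?_, fun k x u u' => ?_⟩
  · have : (1 + N * L) * Real.exp (-(ω - N * L)) =
        Real.exp (-ω + N * L + Real.log (1 + N * L)) := by
      rw [Real.exp_add, Real.exp_log (by positivity), mul_comm]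
      congr 2
      ring
    rw [this]
    exact Real.exp_lt_one_iff.2 hneg
  · refine (key k x u u' _ (by positivity) (hT.adaptedNormLE hΛ x (u - u'))).trans ?_
    have h1 : (k : ℝ) - 1 ≤ moment h x k - x := by
      linarith [le_moment (h := h) hΛ x k, (hΛ x.2).2]
    calc _ ≤ N * ‖u - u'‖ * (1 + N * L) ^ k * Real.exp (-(ω - N * L) * (k - 1)) := by
          gcongr ?_ * Real.exp ?_
          exact mul_le_mul_of_nonpos_left h1 (by linarith)
      _ = _ := by
          rw [show -(ω - N * L) * ((k : ℝ) - 1) = (ω - N * L) + k * (-(ω - N * L)) by ring,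
            Real.exp_add, Real.exp_nat_mul, mul_pow]
          ring

end Contraction

/-! ### Solutions as orbits of the evolution from impulse to impulse -/

section Piece

variable {E : Type*} [NormedAddCommGroup E] [NormedSpace ℝ E] {v : E → E} {φ : E → ℝ → E}
  {z : ℝ → E} {u : E} {a b : ℝ}

/-- A converse of `IsLocalFlow.eq_of_tendsto`: this and the next two lemmas yield the clauses in the
definition of a solution from a piece of the flow. -/
theorem IsLocalFlow.hasDerivAt_of_eqOn (hφ : IsLocalFlow v φ) (hb : b ≤ a + 2)
    (hz : ∀ t ∈ Ioc a b, z t = φ u (t - a)) {t : ℝ} (ht : t ∈ Ioo a b) :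
    HasDerivAt z (v (z t)) t := by
  rw [hz t (Ioo_subset_Ioc_self ht)]
  have h1 := hφ.hasDerivAt u (t - a) ⟨by linarith [ht.1], by linarith [ht.2]⟩
  refine (h1.comp_sub_const t a).congr_of_eventuallyEq ?_
  filter_upwards [Ioo_mem_nhds ht.1 ht.2] with s hs using hz s (Ioo_subset_Ioc_self hs)

theorem IsLocalFlow.hasDerivWithinAt_of_eqOn (hφ : IsLocalFlow v φ) (hab : a < b) (hb : b ≤ a + 2)
    (hz : ∀ t ∈ Ioc a b, z t = φ u (t - a)) : HasDerivWithinAt z (v (z b)) (Iic b) b := by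
  have hbm : b ∈ Ioc a b := ⟨hab, le_rfl⟩
  rw [hz b hbm]
  have h1 := hφ.hasDerivAt u (b - a) ⟨by linarith, by linarith⟩
  refine (h1.comp_sub_const b a).hasDerivWithinAt.congr_of_eventuallyEq ?_ (hz b hbm)
  filter_upwards [Ioc_mem_nhdsLE hab] with s hs using hz s hs

theorem IsLocalFlow.tendsto_of_eqOn (hφ : IsLocalFlow v φ) (hab : a < b)
    (hz : ∀ t ∈ Ioc a b, z t = φ u (t - a)) : Tendsto z (𝓝[>] a) (𝓝 u) := by
  have h1 := ((hφ.hasDerivAt u 0 ⟨le_rfl, zero_le_two⟩).continuousAt.tendsto)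
  have h2 : Tendsto (fun s => s - a) (𝓝[>] a) (𝓝 0) := by
    have : Tendsto (fun s => s - a) (𝓝 a) (𝓝 (a - a)) := (continuous_sub_right a).tendsto a
    rw [sub_self] at this
    exact this.mono_left nhdsWithin_le_nhds
  have h3 := h1.comp h2
  rw [hφ.zero] at h3
  refine h3.congr' ?_
  filter_upwards [Ioc_mem_nhdsGT hab] with s hs using (hz s hs).symm

end Piece

section Sequences

variable {Λ : Set ℝ} {h : Λ → Λ}

theorem moment_strictMono {g : ℝ} (hg : 0 < g) (hgap : ∀ x : Λ, g ≤ 1 + (h x : ℝ) - x) (x : Λ) :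
    StrictMono (moment h x) :=
  strictMono_nat_of_lt_succ fun k => by
    have := hgap (h^[k] x)
    rw [moment_succ_eq_add_gap, momentGap]
    linarith

theorem exists_mem_Ioc_moment (hΛ : Λ ⊆ Icc 0 1) {x : Λ} {t : ℝ} (ht : (x : ℝ) < t) :
    ∃ k, t ∈ Ioc (moment h x k) (moment h x (k + 1)) := by
  have hex : ∃ k, t ≤ moment h x k := ⟨⌈t⌉₊, (Nat.le_ceil t).trans (le_moment hΛ x _)⟩
  classical
  have hpos : Nat.find hex ≠ 0 := fun h0 => by
    have := Nat.find_spec hex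
    rw [h0, moment_zero] at this
    linarith
  obtain ⟨k, hk⟩ := Nat.exists_eq_succ_of_ne_zero hpos
  refine ⟨k, not_le.1 (Nat.find_min hex (m := k) (by lia)), ?_⟩
  rw [← Nat.succ_eq_add_one, ← hk]
  exact Nat.find_spec hex

/-- The index type is general so as to cover forward moments (ℕ) and two-sided ones (ℤ). -/
theorem eq_of_mem_Ioc_of_strictMono {ι : Type*} [LinearOrder ι] [Add ι] [One ι] [SuccAddOrder ι]
    {θ : ι → ℝ} (hθ : StrictMono θ) {i j : ι} {t : ℝ} (hi : t ∈ Ioc (θ i) (θ (i + 1)))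
    (hj : t ∈ Ioc (θ j) (θ (j + 1))) : i = j := by
  have key : ∀ {i j : ι}, t ∈ Ioc (θ i) (θ (i + 1)) → t ∈ Ioc (θ j) (θ (j + 1)) → i ≤ j :=
    fun hi hj => by
      by_contra! hlt
      have := hθ.monotone (Order.add_one_le_of_lt hlt)
      linarith [hi.1, hj.2]
  exact le_antisymm (key hi hj) (key hj hi)

/-- A two-sided sequence of impulses with its initial point. -/
theorem exists_of_mem_impulseSequences {ζ : ℤ → ℝ} (hζ : ζ ∈ impulseSequences h) :
    ∃ κ : ℤ → Λ, (∀ i, κ (i + 1) = h (κ i)) ∧ (∀ i, ζ i = i + κ i) ∧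
      ∀ k : ℕ, ζ k = moment h (κ 0) k := by
  obtain ⟨κ, hκ, hζκ⟩ := hζ
  refine ⟨κ, hκ, hζκ, fun k => ?_⟩
  have : κ k = h^[k] (κ 0) := by
    induction k with
    | zero => rfl
    | succ k ih => rw [Function.iterate_succ_apply', ← ih, ← hκ]; rfl
  rw [hζκ, this, moment]
  rfl

theorem strictMono_of_mem_impulseSequences {g : ℝ} (hg : 0 < g)
    (hgap : ∀ x : Λ, g ≤ 1 + (h x : ℝ) - x) {ζ : ℤ → ℝ} (hζ : ζ ∈ impulseSequences h) :
    StrictMono ζ := by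
  obtain ⟨κ, hκ, hζκ⟩ := hζ
  refine strictMono_int_of_lt_succ fun i => ?_
  have := hgap (κ i)
  rw [hζκ, hζκ, hκ]
  push_cast
  linarith

theorem exists_mem_Ioc_impulse (hΛ : Λ ⊆ Icc 0 1) {ζ : ℤ → ℝ} (hζ : ζ ∈ impulseSequences h)
    (t : ℝ) : ∃ i : ℤ, t ∈ Ioc (ζ i) (ζ (i + 1)) := by
  obtain ⟨κ, hκ, hζκ⟩ := hζ
  have hlow : ∀ i : ℤ, (i : ℝ) ≤ ζ i := fun i => by rw [hζκ]; linarith [(hΛ (κ i).2).1]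
  have hup : ∀ i : ℤ, ζ i ≤ i + 1 := fun i => by rw [hζκ]; linarith [(hΛ (κ i).2).2]
  obtain ⟨i, hi, hmax⟩ := Int.exists_greatest_of_bdd (P := fun i => ζ i < t)
    ⟨⌈t⌉, fun i hi => (Int.cast_le (R := ℝ)).1 (((hlow i).trans hi.le).trans (Int.le_ceil t))⟩
    ⟨⌈t⌉ - 2, (hup _).trans_lt <| by push_cast; linarith [Int.ceil_lt_add_one t]⟩
  exact ⟨i, hi, not_lt.1 fun hlt => absurd (hmax _ hlt) (by lia)⟩

end Sequences

namespace ImpulsiveSystem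

open scoped NNReal

variable {n : ℕ} (P : ImpulsiveSystem n) {Λ : Set ℝ} (h : Λ → Λ)
  (φ : EuclideanSpace ℝ (Fin n) → ℝ → EuclideanSpace ℝ (Fin n))

/-- The vector field of the differential equation. -/
def field (x : EuclideanSpace ℝ (Fin n)) : EuclideanSpace ℝ (Fin n) := P.opA x + P.f x

/-- The state after an impulse as a function of the state before it. -/
def jump (x : EuclideanSpace ℝ (Fin n)) : EuclideanSpace ℝ (Fin n) := x + (P.opB x + P.W x)

/-- The function `z` is composed of the pieces of trajectories that start at the states `u k` at
the moments of impulses. -/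
structure IsForwardOrbit (x : Λ) (u : ℕ → EuclideanSpace ℝ (Fin n))
    (z : ℝ → EuclideanSpace ℝ (Fin n)) : Prop where
  succ : ∀ k, u (k + 1) = postMap h P.opB P.W φ (h^[k] x) (u k)
  eq_flow : ∀ k, ∀ t ∈ Ioc (moment h x k) (moment h x (k + 1)), z t = φ (u k) (t - moment h x k)

variable {P h φ}

theorem IsForwardOrbit.shift {x : Λ} {u : ℕ → EuclideanSpace ℝ (Fin n)}
    {z : ℝ → EuclideanSpace ℝ (Fin n)} (hz : P.IsForwardOrbit h φ x u z) (m : ℕ) :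
    P.IsForwardOrbit h φ (h^[m] x) (fun k => u (m + k)) (fun t => z (t + m)) := by
  refine ⟨fun k => ?_, fun k t ht => ?_⟩
  · rw [← Function.iterate_add_apply, add_comm k m]
    exact hz.succ (m + k)
  · have h1 := moment_add (h := h) x m k
    have h2 := moment_add (h := h) x m (k + 1)
    rw [← add_assoc] at h2
    rw [hz.eq_flow (m + k) (t + m) (by rw [h1, h2]; constructor <;> linarith [ht.1, ht.2]), h1]
    congr 1
    ring

variable {K : ℝ≥0} {g : ℝ}

/-- Forward solutions are composed of pieces of trajectories. -/
theorem IsForwardSolution.isForwardOrbit (hΛ : Λ ⊆ Icc 0 1) (hφ : IsLocalFlow P.field φ)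
    (hv : LipschitzWith K P.field) (hg : 0 < g) (hgap : ∀ x : Λ, g ≤ 1 + (h x : ℝ) - x)
    {ζ : ℤ → ℝ} {x : Λ} (hζ : ∀ k : ℕ, ζ k = moment h x k) {z : ℝ → EuclideanSpace ℝ (Fin n)}
    (hz : P.IsForwardSolution ζ z) :
    P.IsForwardOrbit h φ x (fun k => P.jump (z (moment h x k))) z := by
  have hmono := moment_strictMono hg hgap x
  have heq : ∀ k, ∀ t ∈ Ioc (moment h x k) (moment h x (k + 1)),
      z t = φ (P.jump (z (moment h x k))) (t - moment h x k) := by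
    intro k
    have h1 := hz.2.1 (k + 1 : ℕ) (by positivity)
    have h2 := hz.2.2 (k : ℕ) (by positivity)
    rw [hζ] at h1 h2
    refine hφ.eq_of_tendsto hv ?_ (fun t ht => hz.1 t ?_ fun i hi => ?_) h1.continuousWithinAt h2
    · have := (momentGap_mem (h := h) hΛ (h^[k] x)).2
      rw [moment_succ_eq_add_gap]
      linarith
    · have := hζ 0
      rw [Nat.cast_zero] at this
      rw [this]
      exact (hmono.monotone k.zero_le).trans_lt ht.1
    · lift i to ℕ using hi
      rw [hζ]
      rintro rfl
      have h3 := hmono.lt_iff_lt.1 ht.1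
      have h4 := hmono.lt_iff_lt.1 ht.2
      lia
  refine ⟨fun k => ?_, heq⟩
  have h1 := heq k _ ⟨hmono k.lt_succ_self, le_rfl⟩
  have h2 : moment h x (k + 1) - moment h x k = momentGap h (h^[k] x) := by
    rw [moment_succ_eq_add_gap]
    ring
  rw [Nat.succ_eq_add_one, h2] at h1
  simp only [postMap, jump, h1]

/-- Existence of forward solutions. -/
theorem exists_isForwardSolution (hΛ : Λ ⊆ Icc 0 1) (hφ : IsLocalFlow P.field φ) (hg : 0 < g)
    (hgap : ∀ x : Λ, g ≤ 1 + (h x : ℝ) - x) {ζ : ℤ → ℝ} {x : Λ} (hζ : ∀ k : ℕ, ζ k = moment h x k)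
    (z₀ : EuclideanSpace ℝ (Fin n)) : ∃ z, P.IsForwardSolution ζ z ∧ z (ζ 0) = z₀ := by
  have hmono := moment_strictMono hg hgap x
  have hζ0 : ζ 0 = x := by simpa using hζ 0
  -- An impulse acts at the initial moment too, and z₀ is the value before it; the states after
  -- impulses start from its jump.
  let u : ℕ → EuclideanSpace ℝ (Fin n) := fun k =>
    evolution h (postMap h P.opB P.W φ) k x (P.jump z₀)
  classical
  let z : ℝ → EuclideanSpace ℝ (Fin n) := fun t =>
    if ht : (x : ℝ) < t then
      φ (u (exists_mem_Ioc_moment (h := h) hΛ ht).choose)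
        (t - moment h x (exists_mem_Ioc_moment (h := h) hΛ ht).choose)
    else z₀
  have hz : ∀ k, ∀ t ∈ Ioc (moment h x k) (moment h x (k + 1)),
      z t = φ (u k) (t - moment h x k) := by
    intro k t ht
    have hx : (x : ℝ) < t := by
      rw [← moment_zero (h := h) x]
      exact (hmono.monotone k.zero_le).trans_lt ht.1
    have := eq_of_mem_Ioc_of_strictMono hmono (exists_mem_Ioc_moment (h := h) hΛ hx).choose_spec ht
    simp only [z, dif_pos hx, this]
  have hz0 : z x = z₀ := by simp only [z, lt_irrefl, dif_neg, not_false_iff]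
  have hgap' : ∀ k, moment h x (k + 1) ≤ moment h x k + 2 := fun k => by
    have := (momentGap_mem (h := h) hΛ (h^[k] x)).2
    rw [moment_succ_eq_add_gap]
    linarith
  have hu : ∀ k, u k = P.jump (z (moment h x k)) := by
    intro k
    cases k with
    | zero => simp [u, evolution, hz0]
    | succ k =>
      rw [hz k _ ⟨hmono k.lt_succ_self, le_rfl⟩]
      have h2 : moment h x (k + 1) - moment h x k = momentGap h (h^[k] x) := by
        rw [moment_succ_eq_add_gap]
        ring
      rw [h2]
      simp only [u, evolution_succ]
      rfl
  refine ⟨z, ⟨fun t ht hne => ?_, fun i hi => ?_, fun i hi => ?_⟩, by rw [hζ0, hz0]⟩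
  · rw [hζ0] at ht
    obtain ⟨k, hk⟩ := exists_mem_Ioc_moment (h := h) hΛ ht
    refine hφ.hasDerivAt_of_eqOn (hgap' k) (hz k) ⟨hk.1, lt_of_le_of_ne hk.2 ?_⟩
    rw [← hζ]
    exact hne _ (by positivity)
  · lift i to ℕ using hi.le
    obtain ⟨k, rfl⟩ := Nat.exists_eq_succ_of_ne_zero (n := i) (by lia)
    rw [hζ]
    exact hφ.hasDerivWithinAt_of_eqOn (hmono k.lt_succ_self) (hgap' k) (hz k)
  · lift i to ℕ using hi
    rw [hζ]
    have := hφ.tendsto_of_eqOn (hmono i.lt_succ_self) (hz i)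
    rwa [hu] at this

/-- Solutions on the whole axis are forward solutions. -/
theorem IsSolution.isForwardSolution {ζ : ℤ → ℝ} (hζ : StrictMono ζ)
    {z : ℝ → EuclideanSpace ℝ (Fin n)} (hz : P.IsSolution ζ z) : P.IsForwardSolution ζ z := by
  refine ⟨fun t ht hne => hz.1 t fun i => ?_, fun i _ => hz.2.1 i, fun i _ => hz.2.2 i⟩
  rcases le_or_gt 0 i with hi | hi
  · exact hne i hi
  · exact ((hζ hi).trans ht).ne'

section Whole

variable {κ : ℤ → Λ} {ζ : ℤ → ℝ}

/-- Solutions on the whole axis are composed of pieces of trajectories. -/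
theorem IsSolution.eq_flow (hΛ : Λ ⊆ Icc 0 1) (hφ : IsLocalFlow P.field φ)
    (hv : LipschitzWith K P.field) (hmono : StrictMono ζ) (hκ : ∀ i, κ (i + 1) = h (κ i))
    (hζ : ∀ i, ζ i = i + κ i) {z : ℝ → EuclideanSpace ℝ (Fin n)} (hz : P.IsSolution ζ z) (i : ℤ) :
    (∀ t ∈ Ioc (ζ i) (ζ (i + 1)), z t = φ (P.jump (z (ζ i))) (t - ζ i)) ∧
      P.jump (z (ζ (i + 1))) = postMap h P.opB P.W φ (κ i) (P.jump (z (ζ i))) := by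
  have hgap : ζ (i + 1) - ζ i = momentGap h (κ i) := by
    rw [hζ, hζ, hκ, momentGap]
    push_cast
    ring
  have heq : ∀ t ∈ Ioc (ζ i) (ζ (i + 1)), z t = φ (P.jump (z (ζ i))) (t - ζ i) := by
    refine hφ.eq_of_tendsto hv ?_ (fun t ht => hz.1 t fun j => ?_)
      (hz.2.1 (i + 1)).continuousWithinAt (hz.2.2 i)
    · have := (momentGap_mem (h := h) hΛ (κ i)).2
      linarith
    · rintro rfl
      have h3 := hmono.lt_iff_lt.1 ht.1
      have h4 := hmono.lt_iff_lt.1 ht.2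
      lia
  refine ⟨heq, ?_⟩
  have h1 := heq _ ⟨hmono (lt_add_one i), le_rfl⟩
  rw [hgap] at h1
  simp only [postMap, jump, h1]

/-- Two-sided orbits of the evolution from impulse to impulse give solutions on the whole axis. -/
theorem exists_isSolution (hΛ : Λ ⊆ Icc 0 1) (hφ : IsLocalFlow P.field φ)
    (hmono : StrictMono ζ) (hκ : ∀ i, κ (i + 1) = h (κ i)) (hζ : ∀ i, ζ i = i + κ i)
    {u : ℤ → EuclideanSpace ℝ (Fin n)}
    (hu : ∀ i, u (i + 1) = postMap h P.opB P.W φ (κ i) (u i)) :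
    ∃ z, P.IsSolution ζ z ∧ ∀ i, ∀ t ∈ Ioc (ζ i) (ζ (i + 1)), z t = φ (u i) (t - ζ i) := by
  have hmem := fun t => exists_mem_Ioc_impulse (h := h) hΛ ⟨κ, hκ, hζ⟩ t
  choose idx hidx using hmem
  let z : ℝ → EuclideanSpace ℝ (Fin n) := fun t => φ (u (idx t)) (t - ζ (idx t))
  have hz : ∀ i, ∀ t ∈ Ioc (ζ i) (ζ (i + 1)), z t = φ (u i) (t - ζ i) := by
    intro i t ht
    have := eq_of_mem_Ioc_of_strictMono hmono (hidx t) ht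
    simp only [z, this]
  have hgap : ∀ i, ζ (i + 1) - ζ i = momentGap h (κ i) := fun i => by
    rw [hζ, hζ, hκ, momentGap]
    push_cast
    ring
  have hgap' : ∀ i, ζ (i + 1) ≤ ζ i + 2 := fun i => by
    linarith [(momentGap_mem (h := h) hΛ (κ i)).2, hgap i]
  have hlt : ∀ i, ζ i < ζ (i + 1) := fun i => hmono (lt_add_one i)
  -- The flow has the right limit u i at ζ i, whereas the jump condition refers to z (ζ i), which
  -- belongs to the preceding piece.
  have hj : ∀ i, u i = P.jump (z (ζ i)) := by
    intro i
    obtain ⟨i, rfl⟩ : ∃ j, i = j + 1 := ⟨i - 1, by ring⟩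
    rw [hz i _ ⟨hlt i, le_rfl⟩, hgap, hu]
    rfl
  refine ⟨z, ⟨fun t hne => ?_, fun i => ?_, fun i => ?_⟩, hz⟩
  · exact hφ.hasDerivAt_of_eqOn (hgap' _) (hz _) ⟨(hidx t).1, lt_of_le_of_ne (hidx t).2 (hne _)⟩
  · obtain ⟨i, rfl⟩ : ∃ j, i = j + 1 := ⟨i - 1, by ring⟩
    exact hφ.hasDerivWithinAt_of_eqOn (hlt i) (hgap' i) (hz i)
  · have := hφ.tendsto_of_eqOn (hlt i) (hz i)
    rwa [hj] at this

end Whole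

end ImpulsiveSystem

/-! ### The attractor of bounded solutions -/

namespace ImpulsiveSystem

open scoped NNReal

variable {n : ℕ} {P : ImpulsiveSystem n} {Λ : Set ℝ} {h : Λ → Λ}
  {φ : EuclideanSpace ℝ (Fin n) → ℝ → EuclideanSpace ℝ (Fin n)} {K : ℝ≥0} {g C r : ℝ}

/-- An impulsive system with a flow and with an exponentially contracting evolution, all moments of
impulses of which are separated by at least `g`. -/
structure IsDissipative (P : ImpulsiveSystem n) (h : Λ → Λ)
    (φ : EuclideanSpace ℝ (Fin n) → ℝ → EuclideanSpace ℝ (Fin n)) (K : ℝ≥0) (g C r : ℝ) :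
    Prop where
  subset : Λ ⊆ Icc 0 1
  flow : IsLocalFlow P.field φ
  lipschitz_field : LipschitzWith K P.field
  lipschitz_jump : LipschitzWith K P.jump
  gap_pos : 0 < g
  gap_le : ∀ x : Λ, g ≤ 1 + (h x : ℝ) - x
  contracting : IsContractingEvolution h (postMap h P.opB P.W φ) C r

namespace IsDissipative

theorem norm_jump_le (hP : P.IsDissipative h φ K g C r) (x : EuclideanSpace ℝ (Fin n)) :
    ‖P.jump x‖ ≤ K * ‖x‖ + ‖P.jump 0‖ := by
  have := hP.lipschitz_jump.norm_sub_le x 0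
  rw [sub_zero] at this
  linarith [norm_le_norm_sub_add (P.jump x) (P.jump 0)]

/-- A bound of the flow with initial values in a ball. -/
def flowBound (P : ImpulsiveSystem n) (K : ℝ≥0) (R : ℝ) : ℝ := gronwallBound R K ‖P.field 0‖ 2

theorem norm_flow_le (hP : P.IsDissipative h φ K g C r) {x : EuclideanSpace ℝ (Fin n)} {R : ℝ}
    (hx : ‖x‖ ≤ R) {t : ℝ} (ht : t ∈ Icc (0 : ℝ) 2) : ‖φ x t‖ ≤ flowBound P K R :=
  hP.flow.norm_le hP.lipschitz_field hx ht

theorem strictMono (hP : P.IsDissipative h φ K g C r) (x : Λ) : StrictMono (moment h x) :=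
  moment_strictMono hP.gap_pos hP.gap_le x

theorem moment_succ_le (hP : P.IsDissipative h φ K g C r) (x : Λ) (k : ℕ) :
    moment h x (k + 1) ≤ moment h x k + 2 := by
  rw [moment_succ_eq_add_gap]
  linarith [(momentGap_mem (h := h) hP.subset (h^[k] x)).2]

theorem sub_mem (hP : P.IsDissipative h φ K g C r) {x : Λ} {k : ℕ} {t : ℝ}
    (ht : t ∈ Ioc (moment h x k) (moment h x (k + 1))) :
    t - moment h x k ∈ Icc (0 : ℝ) 2 :=
  ⟨by linarith [ht.1], by linarith [ht.2, hP.moment_succ_le x k]⟩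

/-- The state after an impulse is bounded, uniformly after a transient time. -/
theorem exists_radius (hP : P.IsDissipative h φ K g C r) : ∃ R > 0,
    (∀ (x : Λ) (k : ℕ) (u : EuclideanSpace ℝ (Fin n)),
      ‖evolution h (postMap h P.opB P.W φ) k x u‖ ≤ C * r ^ k * ‖u‖ + R) ∧
    ∀ (κ : ℤ → Λ), (∀ i, κ (i + 1) = h (κ i)) →
      (∃ u : ℤ → EuclideanSpace ℝ (Fin n),
        (∀ i, u (i + 1) = postMap h P.opB P.W φ (κ i) (u i)) ∧ ∀ i, ‖u i‖ ≤ R) ∧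
      ∀ (u : ℤ → EuclideanSpace ℝ (Fin n)) (M : ℝ),
        (∀ i, u (i + 1) = postMap h P.opB P.W φ (κ i) (u i)) → (∀ i, ‖u i‖ ≤ M) →
        ∀ i, ‖u i‖ ≤ R := by
  let e := K * flowBound P K 0 + ‖P.jump 0‖
  have he : ∀ x : Λ, ‖postMap h P.opB P.W φ x 0‖ ≤ e := fun x => by
    refine (hP.norm_jump_le _).trans ?_
    have := hP.norm_flow_le (x := 0) (R := 0) (by simp) (momentGap_mem (h := h) hP.subset x)
    have := mul_le_mul_of_nonneg_left this K.coe_nonneg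
    simp only [e]
    linarith
  have hG := hP.contracting
  -- The maximum with 1 serves only to make the radius positive.
  refine ⟨max 1 (C * e / (1 - r)), by positivity, fun x k u => ?_, fun κ hκ => ⟨?_, ?_⟩⟩
  · exact (hG.norm_evolution_le he k x u).trans (add_le_add_right (le_max_right _ _) _)
  · obtain ⟨u, hu, hb⟩ := hG.exists_bounded he hκ
    exact ⟨u, hu, fun i => (hb i).trans (le_max_right _ _)⟩
  · intro u M hu hM i
    exact (hG.norm_le_of_bounded he hκ hu hM i).trans (le_max_right _ _)

/-- Exponential attraction of solutions with the same moments of impulses. -/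
theorem norm_sub_le (hP : P.IsDissipative h φ K g C r) {x : Λ}
    {u u' : ℕ → EuclideanSpace ℝ (Fin n)} {z z' : ℝ → EuclideanSpace ℝ (Fin n)}
    (hz : P.IsForwardOrbit h φ x u z) (hz' : P.IsForwardOrbit h φ x u' z') {k : ℕ} {t : ℝ}
    (ht : t ∈ Ioc (moment h x k) (moment h x (k + 1))) :
    ‖z t - z' t‖ ≤ Real.exp (K * 2) * (C * r ^ k * ‖u 0 - u' 0‖) := by
  rw [hz.eq_flow k t ht, hz'.eq_flow k t ht]
  refine (hP.flow.norm_sub_le hP.lipschitz_field _ _ (hP.sub_mem ht)).trans ?_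
  gcongr
  rw [eq_evolution hz.succ, eq_evolution hz'.succ]
  exact hP.contracting.norm_sub_le k x _ _

theorem isForwardOrbit (hP : P.IsDissipative h φ K g C r) {ζ : ℤ → ℝ} {x : Λ}
    (hζ : ∀ k : ℕ, ζ k = moment h x k) {z : ℝ → EuclideanSpace ℝ (Fin n)}
    (hz : P.IsForwardSolution ζ z) :
    P.IsForwardOrbit h φ x (fun k => P.jump (z (moment h x k))) z :=
  hz.isForwardOrbit hP.subset hP.flow hP.lipschitz_field hP.gap_pos hP.gap_le hζ

theorem strictMono_impulse (hP : P.IsDissipative h φ K g C r) {ζ : ℤ → ℝ}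
    (hζ : ζ ∈ impulseSequences h) : StrictMono ζ :=
  strictMono_of_mem_impulseSequences hP.gap_pos hP.gap_le hζ

theorem eqOn (hP : P.IsDissipative h φ K g C r) {ζ : ℤ → ℝ} (hζ : ζ ∈ impulseSequences h)
    {z z' : ℝ → EuclideanSpace ℝ (Fin n)} (hz : P.IsForwardSolution ζ z)
    (hz' : P.IsForwardSolution ζ z') (h0 : z (ζ 0) = z' (ζ 0)) : EqOn z z' (Ici (ζ 0)) := by
  obtain ⟨κ, -, -, hm⟩ := exists_of_mem_impulseSequences hζ
  have hζ0 : ζ 0 = κ 0 := by simpa using hm 0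
  intro t ht
  rcases (mem_Ici.1 ht).eq_or_lt with rfl | hlt
  · exact h0
  · rw [hζ0] at hlt h0
    obtain ⟨k, hk⟩ := exists_mem_Ioc_moment (h := h) hP.subset hlt
    have := hP.norm_sub_le (hP.isForwardOrbit hm hz) (hP.isForwardOrbit hm hz') hk
    simpa [h0, sub_eq_zero] using this

theorem tendsto_norm_sub (hP : P.IsDissipative h φ K g C r) {ζ : ℤ → ℝ}
    (hζ : ζ ∈ impulseSequences h) {z z' : ℝ → EuclideanSpace ℝ (Fin n)}
    (hz : P.IsForwardSolution ζ z) (hz' : P.IsForwardSolution ζ z') :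
    Tendsto (fun t => ‖z t - z' t‖) atTop (𝓝 0) := by
  obtain ⟨κ, -, -, hm⟩ := exists_of_mem_impulseSequences hζ
  have h1 := hP.isForwardOrbit hm hz
  have h2 := hP.isForwardOrbit hm hz'
  have hlim := (hP.contracting.tendsto_const_mul
    ‖P.jump (z (moment h (κ 0) 0)) - P.jump (z' (moment h (κ 0) 0))‖).const_mul (Real.exp (K * 2))
  rw [mul_zero] at hlim
  rw [Metric.tendsto_atTop]
  intro ε hε
  obtain ⟨k₀, hk₀⟩ := eventually_atTop.1 (hlim.eventually (gt_mem_nhds hε))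
  refine ⟨moment h (κ 0) k₀ + 1, fun t ht => ?_⟩
  have hpos : (κ 0 : ℝ) < t := by
    have := (hP.strictMono (κ 0)).monotone k₀.zero_le
    rw [moment_zero] at this
    linarith
  obtain ⟨k, hk⟩ := exists_mem_Ioc_moment (h := h) hP.subset hpos
  have hk' : k₀ ≤ k := by
    by_contra! hlt
    have := (hP.strictMono (κ 0)).monotone (Nat.succ_le_of_lt hlt)
    rw [Nat.succ_eq_add_one] at this
    linarith [hk.2]
  rw [Real.dist_0_eq_abs, abs_norm]
  exact (hP.norm_sub_le h1 h2 hk).trans_lt (hk₀ k hk')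

/-- The orbit of the states after impulses of a bounded solution. -/
theorem bounded_jump (hP : P.IsDissipative h φ K g C r) {ζ : ℤ → ℝ} {κ : ℤ → Λ}
    (hκ : ∀ i, κ (i + 1) = h (κ i)) (hζ : ∀ i, ζ i = i + κ i)
    {z : ℝ → EuclideanSpace ℝ (Fin n)} (hz : P.IsBoundedSolution ζ z) :
    (∀ i, ∀ t ∈ Ioc (ζ i) (ζ (i + 1)), z t = φ (P.jump (z (ζ i))) (t - ζ i)) ∧
    (∀ i, P.jump (z (ζ (i + 1))) = postMap h P.opB P.W φ (κ i) (P.jump (z (ζ i)))) ∧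
    ∃ M, ∀ i, ‖P.jump (z (ζ i))‖ ≤ M := by
  obtain ⟨hz, M, hM⟩ := hz
  have := fun i => hz.eq_flow hP.subset hP.flow hP.lipschitz_field
    (hP.strictMono_impulse ⟨κ, hκ, hζ⟩) hκ hζ i
  refine ⟨fun i => (this i).1, fun i => (this i).2, K * M + ‖P.jump 0‖, fun i => ?_⟩
  refine (hP.norm_jump_le _).trans ?_
  gcongr
  exact hM _

theorem sub_mem_impulse (hP : P.IsDissipative h φ K g C r) {ζ : ℤ → ℝ} {κ : ℤ → Λ}
    (hκ : ∀ i, κ (i + 1) = h (κ i)) (hζ : ∀ i, ζ i = i + κ i) {i : ℤ} {t : ℝ}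
    (ht : t ∈ Ioc (ζ i) (ζ (i + 1))) : t - ζ i ∈ Icc (0 : ℝ) 2 := by
  have h1 := (momentGap_mem (h := h) hP.subset (κ i)).2
  have h2 : ζ (i + 1) - ζ i = momentGap h (κ i) := by
    rw [hζ, hζ, hκ, momentGap]
    push_cast
    ring
  exact ⟨by linarith [ht.1], by linarith [ht.2]⟩

theorem eq_of_isBoundedSolution (hP : P.IsDissipative h φ K g C r) {ζ : ℤ → ℝ}
    (hζ : ζ ∈ impulseSequences h) {z z' : ℝ → EuclideanSpace ℝ (Fin n)}
    (hz : P.IsBoundedSolution ζ z) (hz' : P.IsBoundedSolution ζ z') : z = z' := by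
  obtain ⟨κ, hκ, hζκ⟩ := id hζ
  obtain ⟨h1, h2, M, hM⟩ := hP.bounded_jump hκ hζκ hz
  obtain ⟨h1', h2', M', hM'⟩ := hP.bounded_jump hκ hζκ hz'
  have heq := hP.contracting.eq_of_bounded hκ (u := fun i => P.jump (z (ζ i)))
    (u' := fun i => P.jump (z' (ζ i))) h2 h2'
    (fun i => (hM i).trans (le_max_left M M')) (fun i => (hM' i).trans (le_max_right M M'))
  ext1 t
  obtain ⟨i, hi⟩ := exists_mem_Ioc_impulse hP.subset hζ t
  rw [h1 i t hi, h1' i t hi, heq i]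

theorem exists_isBoundedSolution (hP : P.IsDissipative h φ K g C r) {ζ : ℤ → ℝ}
    (hζ : ζ ∈ impulseSequences h) : ∃ z, P.IsBoundedSolution ζ z := by
  obtain ⟨R, -, -, hR⟩ := hP.exists_radius
  obtain ⟨κ, hκ, hζκ⟩ := id hζ
  obtain ⟨⟨u, hu, hb⟩, -⟩ := hR κ hκ
  obtain ⟨z, hz, hzu⟩ := exists_isSolution hP.subset hP.flow (hP.strictMono_impulse hζ) hκ hζκ hu
  refine ⟨z, hz, flowBound P K R, fun t => ?_⟩
  obtain ⟨i, hi⟩ := exists_mem_Ioc_impulse hP.subset hζ t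
  rw [hzu i t hi]
  exact hP.norm_flow_le (hb i) (hP.sub_mem_impulse hκ hζκ hi)

theorem exists_uniform_bound (hP : P.IsDissipative h φ K g C r) :
    ∃ M, ∀ ζ ∈ impulseSequences h, ∀ z, P.IsBoundedSolution ζ z → ∀ t, ‖z t‖ ≤ M := by
  obtain ⟨R, -, -, hR⟩ := hP.exists_radius
  refine ⟨flowBound P K R, fun ζ hζ z hz t => ?_⟩
  obtain ⟨κ, hκ, hζκ⟩ := id hζ
  obtain ⟨h1, h2, M, hM⟩ := hP.bounded_jump hκ hζκ hz
  obtain ⟨i, hi⟩ := exists_mem_Ioc_impulse hP.subset hζ t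
  rw [h1 i t hi]
  exact hP.norm_flow_le ((hR κ hκ).2 (fun i => P.jump (z (ζ i))) M h2 hM i)
    (hP.sub_mem_impulse hκ hζκ hi)

theorem isAttractorPCB (hP : P.IsDissipative h φ K g C r) : P.IsAttractorPCB h := by
  refine ⟨fun ζ hζ => ?_, hP.exists_uniform_bound, fun ζ hζ z₀ => ?_,
    fun ζ hζ z z' hz hz' h0 => hP.eqOn hζ hz hz' h0, fun ζ hζ z z' hz hz' => ?_⟩
  · obtain ⟨z, hz⟩ := hP.exists_isBoundedSolution hζ
    exact ⟨z, hz, fun z' hz' => hP.eq_of_isBoundedSolution hζ hz' hz⟩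
  · obtain ⟨κ, -, -, hm⟩ := exists_of_mem_impulseSequences hζ
    exact exists_isForwardSolution hP.subset hP.flow hP.gap_pos hP.gap_le hm z₀
  · exact hP.tendsto_norm_sub hζ (hz.1.isForwardSolution (hP.strictMono_impulse hζ)) hz'

/-- The bounded solution with a periodic sequence of impulses is periodic. -/
theorem isPeriodicSolution (hP : P.IsDissipative h φ K g C r) {ζ : ℤ → ℝ}
    (hζ : ζ ∈ impulseSequences h) {p : ℕ} (hp : 0 < p) (hper : HasPeriod ζ p)
    {z : ℝ → EuclideanSpace ℝ (Fin n)} (hz : P.IsBoundedSolution ζ z) :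
    P.IsPeriodicSolution ζ z := by
  -- The translate by the period has the same impulse moments, so uniqueness of the bounded solution
  -- identifies it with z.
  have hshift : P.IsBoundedSolution ζ (fun t => z (t + p)) := by
    obtain ⟨⟨h1, h2, h3⟩, M, hM⟩ := hz
    refine ⟨⟨fun t ht => ?_, fun i => ?_, fun i => ?_⟩, M, fun t => hM _⟩
    · refine HasDerivAt.comp_add_const t (p : ℝ) (h1 (t + p) fun i hi => ht (i - p) ?_)
      have := hper (i - p)
      rw [sub_add_cancel] at this
      linarith
    · have := h2 (i + p)
      rw [hper] at this
      have hd := this.scomp_of_eq (ζ i) (((hasDerivAt_id (ζ i)).add_const (p : ℝ)).hasDerivWithinAt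
        (s := Iic (ζ i))) (fun t ht => by simpa using ht) rfl
      simpa [Function.comp_def] using hd
    · have := h3 (i + p)
      rw [hper] at this
      refine this.comp (tendsto_nhdsWithin_iff.2 ⟨?_, ?_⟩)
      · exact ((continuous_add_const (p : ℝ)).tendsto (ζ i)).mono_left nhdsWithin_le_nhds
      · filter_upwards [self_mem_nhdsWithin] with t ht
        simpa using ht
  refine ⟨hz, p, hp, hper, fun t => ?_⟩
  exact congrFun (hP.eq_of_isBoundedSolution hζ hshift hz) t

end IsDissipative

end ImpulsiveSystem

/-! ### Density of periodic solutions and of a single solution -/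

/-- ε-equivalence exempts times between two corresponding moments only if both lie in J, so the ends
of J have to keep away from all moments. Two left ends are tried, g/4 and g/2 after θ k₀. One moment
cannot be δ-close to both right ends, as 2δ < g/4; nor can two different moments, as they are g
apart. -/
theorem exists_window {θ : ℕ → ℝ} {g : ℝ} (hθ : ∀ i, θ i + g ≤ θ (i + 1)) {δ : ℝ} (hg : 0 < g)
    (hδg : δ ≤ g / 16) (k₀ : ℕ) (E : ℝ) :
    ∃ a ∈ Ioo (θ k₀) (θ (k₀ + 1)), ∀ j, δ < |a - θ j| ∧ δ < |a + E - θ j| := by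
  have hmono : StrictMono θ := strictMono_nat_of_lt_succ fun i => by linarith [hθ i]
  have hsep : ∀ {i j}, i < j → θ i + g ≤ θ j := fun {i j} hij =>
    (hθ i).trans (hmono.monotone (Nat.succ_le_of_lt hij))
  have hfirst : ∀ b ∈ Icc (g / 4) (g / 2), ∀ j, δ < |θ k₀ + b - θ j| := by
    intro b hb j
    rw [lt_abs]
    rcases le_or_gt j k₀ with hj | hj
    · left
      linarith [hmono.monotone hj, hb.1]
    · right
      linarith [hsep hj, hb.2]
  have hsnd : (∀ j, δ < |θ k₀ + g / 4 + E - θ j|) ∨ ∀ j, δ < |θ k₀ + g / 2 + E - θ j| := by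
    by_contra! H
    obtain ⟨⟨i, hi⟩, j, hj⟩ := H
    rw [abs_le] at hi hj
    rcases lt_trichotomy i j with hij | rfl | hij
    · linarith [hsep hij, hi.1, hj.2]
    · linarith [hi.1, hj.2]
    · linarith [hsep hij, hi.1, hj.2]
  have hk := hθ k₀
  rcases hsnd with H | H
  · exact ⟨θ k₀ + g / 4, ⟨by linarith, by linarith⟩, fun j =>
      ⟨hfirst _ ⟨le_rfl, by linarith⟩ j, H j⟩⟩
  · exact ⟨θ k₀ + g / 2, ⟨by linarith, by linarith⟩, fun j =>
      ⟨hfirst _ ⟨by linarith, le_rfl⟩ j, H j⟩⟩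

namespace ImpulsiveSystem

open scoped NNReal

variable {n : ℕ} {P : ImpulsiveSystem n} {Λ : Set ℝ} {h : Λ → Λ}
  {φ : EuclideanSpace ℝ (Fin n) → ℝ → EuclideanSpace ℝ (Fin n)} {K : ℝ≥0} {g C r : ℝ}

namespace IsDissipative

/-- The speed of the flow with initial values in a ball. -/
def speedBound (P : ImpulsiveSystem n) (K : ℝ≥0) (R : ℝ) : ℝ :=
  K * flowBound P K R + ‖P.field 0‖

theorem norm_flow_sub_le (hP : P.IsDissipative h φ K g C r) {x : EuclideanSpace ℝ (Fin n)} {R : ℝ}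
    (hx : ‖x‖ ≤ R) {s t : ℝ} (hs : s ∈ Icc (0 : ℝ) 2) (ht : t ∈ Icc (0 : ℝ) 2) :
    ‖φ x t - φ x s‖ ≤ speedBound P K R * |t - s| :=
  hP.flow.norm_sub_time_le hP.lipschitz_field hx hs ht

theorem speedBound_nonneg (hP : P.IsDissipative h φ K g C r) {R : ℝ} (hR : 0 ≤ R) :
    0 ≤ speedBound P K R := by
  have h1 := hP.norm_flow_le (x := 0) (R := R) (by simpa) (t := 0) (by simp)
  have : 0 ≤ flowBound P K R := (norm_nonneg _).trans h1
  unfold speedBound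
  positivity

/-- Two orbits with close moments of impulses approach each other. -/
theorem norm_sub_le_of_moments_close (hP : P.IsDissipative h φ K g C r) {R δ : ℝ}
    (hR : 0 ≤ R) (hδ : 0 ≤ δ) {x y : Λ} {u u' : ℕ → EuclideanSpace ℝ (Fin n)}
    (hu : ∀ k, u (k + 1) = postMap h P.opB P.W φ (h^[k] x) (u k))
    (hu' : ∀ k, u' (k + 1) = postMap h P.opB P.W φ (h^[k] y) (u' k))
    (hR' : ∀ k, ‖u' k‖ ≤ R) {k : ℕ} (hxy : ∀ j ≤ k, |(h^[j] x : ℝ) - h^[j] y| ≤ δ) :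
    ‖u k - u' k‖ ≤ C * r ^ k * ‖u 0 - u' 0‖ +
      C * (K * (speedBound P K R * (2 * δ))) / (1 - r) := by
  have hV := hP.speedBound_nonneg hR
  rw [eq_evolution hu]
  -- The orbit u' is an approximate orbit for the moments of x: corresponding gaps differ by at most
  -- 2δ, the flow has bounded speed, and the jump is K-Lipschitz.
  refine hP.contracting.norm_sub_le_of_approx (by positivity) (fun i hi => ?_) (u 0)
  rw [hu']
  refine (hP.lipschitz_jump.norm_sub_le _ _).trans ?_
  gcongr
  refine (hP.norm_flow_sub_le (hR' i) (momentGap_mem (h := h) hP.subset _)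
    (momentGap_mem (h := h) hP.subset _)).trans ?_
  gcongr
  have h1 := abs_le.1 (hxy i hi.le)
  have h2 := abs_le.1 (hxy (i + 1) hi)
  rw [Function.iterate_succ_apply', Function.iterate_succ_apply'] at h2
  simp only [momentGap]
  rw [abs_le]
  constructor <;> linarith [h1.1, h1.2, h2.1, h2.2]

theorem moment_add_gap_le (hP : P.IsDissipative h φ K g C r) (x : Λ) (k : ℕ) :
    moment h x k + g ≤ moment h x (k + 1) := by
  rw [moment_succ_eq_add_gap, momentGap]
  linarith [hP.gap_le (h^[k] x)]

/-- Orbits with moments of impulses that are close for a long time are equivalent on a long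
interval. -/
theorem exists_epsEquivalent (hP : P.IsDissipative h φ K g C r) (ρ : ℝ) {ε E : ℝ}
    (hε : 0 < ε) : ∃ δ > 0, ∃ N : ℕ, ∀ (x y : Λ) (ζ η : ℤ → ℝ)
      (u u' : ℕ → EuclideanSpace ℝ (Fin n)) (z z' : ℝ → EuclideanSpace ℝ (Fin n)),
      (∀ k : ℕ, ζ k = moment h x k) → (∀ i < 0, ζ i ≤ 0) → (∀ k : ℕ, η k = moment h y k) →
      P.IsForwardOrbit h φ x u z → P.IsForwardOrbit h φ y u' z' → ‖u 0‖ ≤ ρ → ‖u' 0‖ ≤ ρ →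
      (∀ k ≤ N, |(h^[k] x : ℝ) - h^[k] y| < δ) →
      ∃ a ≥ 1, EpsEquivalent ε a (a + E) ζ z η z' := by
  obtain ⟨R₀, hR₀, hR, -⟩ := hP.exists_radius
  have hr0 := hP.contracting.rate_nonneg
  have hr1 : 0 < 1 - r := sub_pos.2 hP.contracting.rate_lt_one
  have hC := hP.contracting.nonneg
  have hg := hP.gap_pos
  let R := C * |ρ| + R₀
  have hRpos : 0 ≤ R := by positivity
  let V := speedBound P K R
  have hV : 0 ≤ V := hP.speedBound_nonneg hRpos
  -- D δ collects the error of the states caused by different moments and the time offset V δ within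
  -- a piece. It takes one half of ε; the transient after k₁ impulses takes the other.
  let D := Real.exp (K * 2) * (C * (K * (V * 2)) / (1 - r)) + V
  have hD : 0 ≤ D := by positivity
  let δ := min (g / 16) (min ε (ε / (2 * (D + 1))))
  have hδ : 0 < δ := by positivity
  have hδg : δ ≤ g / 16 := min_le_left _ _
  have hδε : δ ≤ ε := (min_le_right _ _).trans (min_le_left _ _)
  have hDδ : D * δ < ε / 2 := by
    have h1 : δ ≤ ε / (2 * (D + 1)) := (min_le_right _ _).trans (min_le_right _ _)
    rw [le_div_iff₀ (by positivity)] at h1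
    nlinarith
  have hlim := (hP.contracting.tendsto_const_mul (2 * |ρ|)).const_mul (Real.exp (K * 2))
  rw [mul_zero] at hlim
  obtain ⟨k₁, hk₁⟩ := eventually_atTop.1 (hlim.eventually (gt_mem_nhds (half_pos hε)))
  let k₀ := k₁ + 1
  refine ⟨δ, hδ, k₀ + ⌈|E|⌉₊ + 3, fun x y ζ η u u' z z' hζ hζneg hη hz hz' hu hu' hxy => ?_⟩
  have hbd : ∀ {x : Λ} {u : ℕ → EuclideanSpace ℝ (Fin n)} {z : ℝ → EuclideanSpace ℝ (Fin n)},
      P.IsForwardOrbit h φ x u z → ‖u 0‖ ≤ ρ → ∀ k, ‖u k‖ ≤ R := by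
    intro x u z hz hu k
    rw [eq_evolution hz.succ]
    refine (hR x k (u 0)).trans (add_le_add_left ?_ _)
    have h1 : r ^ k ≤ 1 := pow_le_one₀ hr0 hP.contracting.rate_lt_one.le
    calc C * r ^ k * ‖u 0‖ ≤ C * 1 * |ρ| := by
          gcongr
          exact hu.trans (le_abs_self ρ)
      _ = _ := by ring
  obtain ⟨a, ha, hwin⟩ := exists_window (θ := moment h x) (fun k => hP.moment_add_gap_le x k) hg
    hδg k₀ E
  have hk₀1 : (1 : ℝ) ≤ k₀ := by simp [k₀]
  have hak₀ : (k₀ : ℝ) < a := (le_moment (h := h) hP.subset x k₀).trans_lt ha.1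
  have ha1 : 1 ≤ a := hk₀1.trans hak₀.le
  have ha2 : a < k₀ + 2 := by
    have := moment_le (h := h) hP.subset x (k₀ + 1)
    push_cast at this
    linarith [ha.2]
  have hidx : ∀ {k : ℕ}, moment h x k < a + E → k + 1 ≤ k₀ + ⌈|E|⌉₊ + 3 := by
    intro k hk
    have h1 := le_moment (h := h) hP.subset x k
    have h2 : (k : ℝ) < k₀ + ⌈|E|⌉₊ + 2 := by linarith [Nat.le_ceil |E|, le_abs_self E]
    have h3 : k < k₀ + ⌈|E|⌉₊ + 2 := by exact_mod_cast h2
    lia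
  have hmom : ∀ k ≤ k₀ + ⌈|E|⌉₊ + 3, |moment h x k - moment h y k| < δ := fun k hk => by
    simpa [moment] using hxy k hk
  refine ⟨a, ha1, fun i hi _ => ?_, fun t ht hout => ?_⟩
  · rcases lt_or_ge i 0 with hi0 | hi0
    · linarith [hζneg i hi0, hi.1]
    · lift i to ℕ using hi0
      rw [hζ] at hi
      rw [hζ, hη]
      exact (hmom i (by have := hidx hi.2; lia)).trans_le hδε
  · have hxt : (x : ℝ) < t := by linarith [(hP.subset x.2).2, ht.1]
    obtain ⟨k, hk⟩ := exists_mem_Ioc_moment (h := h) hP.subset hxt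
    have hkN := hidx (hk.1.trans ht.2)
    have hd := abs_lt.1 (hmom k (by lia))
    have hd' := abs_lt.1 (hmom (k + 1) hkN)
    -- Otherwise t lies between two corresponding moments. The window puts both into J, and t would
    -- be exempt.
    have hk' : t ∈ Ioc (moment h y k) (moment h y (k + 1)) := by
      constructor
      · by_contra! hle
        obtain ⟨w1, w2⟩ := hwin k
        rw [lt_abs] at w1 w2
        have e1 : moment h x k < a + E - δ := by
          rcases w2 with w | w <;> linarith [hk.1, ht.2]
        have e2 : a + δ < moment h x k := by
          rcases w1 with w | w <;> linarith [ht.1, hd.1]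
        have e3 : a < moment h x k := by linarith
        refine hout k ?_ ?_ ?_
        · rw [hζ]; exact ⟨e3, by linarith⟩
        · rw [hη]; exact ⟨by linarith [ht.1], by linarith [hd.1]⟩
        · rw [hζ, hη]; exact mem_uIcc.2 (Or.inl ⟨hk.1.le, hle⟩)
      · by_contra! hlt
        obtain ⟨w1, w2⟩ := hwin (k + 1)
        rw [lt_abs] at w1 w2
        have e1 : a + δ < moment h x (k + 1) := by
          rcases w1 with w | w <;> linarith [hk.2, ht.1]
        have e2 : moment h x (k + 1) < a + E - δ := by
          rcases w2 with w | w <;> linarith [ht.2, hd'.2]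
        refine hout (k + 1 : ℕ) ?_ ?_ ?_
        · rw [hζ]; exact ⟨by linarith, by linarith⟩
        · rw [hη]; exact ⟨by linarith [hd'.2], by linarith [ht.2]⟩
        · rw [hζ, hη]; exact mem_uIcc.2 (Or.inr ⟨hlt.le, hk.2⟩)
    have hkk₀ : k₁ ≤ k := by
      by_contra! hlt
      have := (hP.strictMono x).monotone (show k + 1 ≤ k₀ by lia)
      linarith [hk.2, ha.1, ht.1]
    rw [hz.eq_flow k t hk, hz'.eq_flow k t hk']
    have b1 := hP.flow.norm_sub_le hP.lipschitz_field (u k) (u' k) (hP.sub_mem hk)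
    have b2 : ‖φ (u' k) (t - moment h x k) - φ (u' k) (t - moment h y k)‖ ≤ V * δ := by
      refine (hP.norm_flow_sub_le (hbd hz' hu' k) (hP.sub_mem hk') (hP.sub_mem hk)).trans ?_
      refine mul_le_mul_of_nonneg_left ?_ hV
      rw [abs_le]
      constructor <;> linarith [hd.1, hd.2]
    have b3 := hP.norm_sub_le_of_moments_close hRpos hδ.le hz.succ hz'.succ (hbd hz' hu')
      (k := k) fun j hj => (hxy j (by lia)).le
    have b4 : C * r ^ k * ‖u 0 - u' 0‖ ≤ C * r ^ k * (2 * |ρ|) := by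
      gcongr
      linarith [_root_.norm_sub_le (u 0) (u' 0), le_abs_self ρ]
    have b5 := hk₁ k hkk₀
    have b6 : Real.exp (K * 2) * ‖u k - u' k‖ ≤ Real.exp (K * 2) * (C * r ^ k * (2 * |ρ|) +
        C * (K * (V * (2 * δ))) / (1 - r)) := by
      gcongr
      exact b3.trans (add_le_add_left b4 _)
    have b7 : Real.exp (K * 2) * (C * (K * (V * (2 * δ))) / (1 - r)) + V * δ = D * δ := by
      simp only [D]
      ring
    have b8 := norm_sub_le_norm_sub_add_norm_sub (φ (u k) (t - moment h x k))
      (φ (u' k) (t - moment h x k)) (φ (u' k) (t - moment h y k))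
    rw [mul_add] at b6
    linarith

theorem le_zero_of_neg (hΛ : Λ ⊆ Icc 0 1) {ζ : ℤ → ℝ} {κ : ℤ → Λ} (hζ : ∀ i, ζ i = i + κ i)
    (m i : ℤ) (hi : i < 0) : ζ (i + m) - m ≤ 0 := by
  have h1 := (hΛ (κ (i + m)).2).2
  have h2 : (i : ℝ) + 1 ≤ 0 := by exact_mod_cast hi
  rw [hζ]
  push_cast
  linarith

/-- A long initial word of the code of ζ 0 is repeated periodically. The bounded solution with the
resulting moments is periodic, and it follows z as long as the codes agree. -/
theorem periodicDenseInPC (hP : P.IsDissipative h φ K g C r) {S : Λ ≃ₜ (ℕ → Fin 2)}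
    (hS : ∀ x, S (h x) = shiftMap (S x)) : P.PeriodicDenseInPC h := by
  obtain ⟨M, hM⟩ := hP.exists_uniform_bound
  intro ζ hζ z hz ε hε E _
  obtain ⟨κ, -, -, hm⟩ := exists_of_mem_impulseSequences hζ
  have hζ0 : ζ 0 = κ 0 := by simpa using hm 0
  have ho := hP.isForwardOrbit hm hz
  obtain ⟨δ, hδ, N, key⟩ := hP.exists_epsEquivalent
    (max (K * M + ‖P.jump 0‖) ‖P.jump (z (moment h (κ 0) 0))‖) (E := E) hε
  obtain ⟨R, hR⟩ := exists_code_modulus_iterate hS hδ N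
  obtain ⟨κ', hκ', hper, hcode⟩ := exists_periodic_orbit hS (κ 0) R
  let η : ℤ → ℝ := fun i => i + κ' i
  have hη : η ∈ impulseSequences h := ⟨κ', hκ', fun _ => rfl⟩
  obtain ⟨κ'', -, hηκ, hm'⟩ := exists_of_mem_impulseSequences hη
  have h0 : κ'' 0 = κ' 0 := Subtype.ext (by simpa [η] using (hηκ 0).symm)
  obtain ⟨w, hw⟩ := hP.exists_isBoundedSolution hη
  have hηper : HasPeriod η (R + 1) := fun i => by
    have := hper i
    push_cast at this
    simp only [η]
    push_cast
    rw [this]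
    ring
  have ho' := hP.isForwardOrbit hm' (hw.1.isForwardSolution (hP.strictMono_impulse hη))
  obtain ⟨a, ha, hae⟩ := key _ _ η ζ _ _ w z hm'
    (fun i hi => by simpa using le_zero_of_neg hP.subset (fun i => rfl) 0 i hi) hm ho' ho
    (le_max_of_le_left ((hP.norm_jump_le _).trans (by gcongr; exact hM η hη w hw _)))
    (le_max_right _ _) (hR _ _ fun i hi => by rw [h0]; exact hcode i hi.le)
  refine ⟨η, hη, w, hP.isPeriodicSolution hη R.succ_pos hηper hw, a, ?_, ?_, hae⟩
  · rw [hζ0]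
    exact ((hP.subset (κ 0).2).2).trans ha
  · simpa [η] using ((hP.subset (κ' 0).2).2).trans ha

theorem periodicDenseInPCB (hP : P.IsDissipative h φ K g C r) {S : Λ ≃ₜ (ℕ → Fin 2)}
    (hS : ∀ x, S (h x) = shiftMap (S x)) : P.PeriodicDenseInPCB h := fun ζ hζ z hz =>
  hP.periodicDenseInPC hS ζ hζ z (hz.1.isForwardSolution (hP.strictMono_impulse hζ))

/-- There is a bounded solution that is dense in the set of all forward solutions. -/
theorem exists_dense (hP : P.IsDissipative h φ K g C r) {S : Λ ≃ₜ (ℕ → Fin 2)}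
    (hS : ∀ x, S (h x) = shiftMap (S x)) :
    ∃ ζ ∈ impulseSequences h, ∃ z, P.IsBoundedSolution ζ z ∧
      ∀ η ∈ impulseSequences h, ∀ z₁, P.IsForwardSolution η z₁ → ∀ ε > 0, ∀ E > 0,
        ∃ (m : ℤ) (a : ℝ), η 0 ≤ a ∧ ζ 0 ≤ a + m ∧
          EpsEquivalent ε a (a + E) (fun i => ζ (i + m) - m) (fun t => z (t + m)) η z₁ := by
  obtain ⟨M, hM⟩ := hP.exists_uniform_bound
  obtain ⟨x, hx⟩ := exists_dense_orbit hS
  obtain ⟨κ, hκ, rfl⟩ := exists_orbit hS x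
  let ζ : ℤ → ℝ := fun i => i + κ i
  have hζ : ζ ∈ impulseSequences h := ⟨κ, hκ, fun _ => rfl⟩
  obtain ⟨κ'', -, hζκ, hm⟩ := exists_of_mem_impulseSequences hζ
  have h0 : κ'' 0 = κ 0 := Subtype.ext (by simpa [ζ] using (hζκ 0).symm)
  rw [h0] at hm
  obtain ⟨z, hz⟩ := hP.exists_isBoundedSolution hζ
  have ho := hP.isForwardOrbit hm (hz.1.isForwardSolution (hP.strictMono_impulse hζ))
  refine ⟨ζ, hζ, z, hz, fun η hη z₁ hz₁ ε hε E _ => ?_⟩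
  obtain ⟨κ₁, -, -, hm₁⟩ := exists_of_mem_impulseSequences hη
  have ho₁ := hP.isForwardOrbit hm₁ hz₁
  -- The translation m is chosen only after N, so the bound of the initial states must not depend on
  -- m; the uniform bound M covers z at every moment.
  obtain ⟨δ, hδ, N, key⟩ := hP.exists_epsEquivalent
    (max (K * M + ‖P.jump 0‖) ‖P.jump (z₁ (moment h (κ₁ 0) 0))‖) (E := E) hε
  obtain ⟨R, hR⟩ := exists_code_modulus_iterate hS hδ N
  obtain ⟨m, hmR⟩ := hx (κ₁ 0) R
  obtain ⟨a, ha, hae⟩ := key _ _ (fun i => ζ (i + m) - m) η _ _ _ z₁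
    (fun k => by
      have := hm (m + k)
      rw [moment_add] at this
      push_cast at this ⊢
      rw [add_comm (k : ℤ), this]
      ring)
    (fun i hi => by
      have := le_zero_of_neg hP.subset (ζ := ζ) (κ := κ) (fun _ => rfl) m i hi
      push_cast at this
      exact this) hm₁
    (ho.shift m) ho₁
    (le_max_of_le_left ((hP.norm_jump_le _).trans (by gcongr; exact hM ζ hζ z hz _)))
    (le_max_right _ _) (hR _ _ hmR)
  refine ⟨m, a, ?_, ?_, by simpa using hae⟩
  · have := hm₁ 0
    rw [Nat.cast_zero, moment_zero] at this
    rw [this]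
    exact ((hP.subset (κ₁ 0).2).2).trans ha
  · have h1 : ζ 0 ≤ 1 := by simpa [ζ] using (hP.subset (κ 0).2).2
    push_cast
    linarith [m.cast_nonneg (α := ℝ)]

theorem hasDenseOrbitInPC (hP : P.IsDissipative h φ K g C r) {S : Λ ≃ₜ (ℕ → Fin 2)}
    (hS : ∀ x, S (h x) = shiftMap (S x)) : P.HasDenseOrbitInPC h := by
  obtain ⟨ζ, hζ, z, hz, H⟩ := hP.exists_dense hS
  exact ⟨ζ, hζ, z, hz.1.isForwardSolution (hP.strictMono_impulse hζ), H⟩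

theorem hasDenseOrbitInPCB (hP : P.IsDissipative h φ K g C r) {S : Λ ≃ₜ (ℕ → Fin 2)}
    (hS : ∀ x, S (h x) = shiftMap (S x)) : P.HasDenseOrbitInPCB h := by
  obtain ⟨ζ, hζ, z, hz, H⟩ := hP.exists_dense hS
  exact ⟨ζ, hζ, z, hz, fun η hη z₁ hz₁ =>
    H η hη z₁ (hz₁.1.isForwardSolution (hP.strictMono_impulse hη))⟩

end IsDissipative

end ImpulsiveSystem

/-! ### Sensitivity -/

theorem StrictMono.notMem_Icc_of_subset_Ioo {θ : ℤ → ℝ} (hθ : StrictMono θ) {j : ℤ} {a b : ℝ}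
    (h : Icc a b ⊆ Ioo (θ j) (θ (j + 1))) (i : ℤ) : θ i ∉ Icc a b := fun hi => by
  have h1 := hθ.lt_iff_lt.1 (h hi).1
  have h2 := hθ.lt_iff_lt.1 (h hi).2
  lia

namespace ImpulsiveSystem

open scoped NNReal

variable {n : ℕ} {P : ImpulsiveSystem n} {Λ : Set ℝ} {h : Λ → Λ}
  {φ : EuclideanSpace ℝ (Fin n) → ℝ → EuclideanSpace ℝ (Fin n)} {K : ℝ≥0} {g C r : ℝ}

namespace IsDissipative

/-- If an impulse of one orbit occurs while the other one has no impulse, then the two orbits are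
far from each other either before or after that impulse. -/
theorem exists_separation (hP : P.IsDissipative h φ K g C r) {R J c : ℝ} (hR : 0 ≤ R) (hJ : 0 < J)
    (hc : 0 < c) (hjump : ∀ x, ‖x‖ ≤ flowBound P K R → J ≤ ‖P.jump x - x‖) :
    ∃ τ > 0, ∀ (x y : Λ) (u u' : ℕ → EuclideanSpace ℝ (Fin n))
      (z z' : ℝ → EuclideanSpace ℝ (Fin n)) (k : ℕ),
      P.IsForwardOrbit h φ x u z → P.IsForwardOrbit h φ y u' z' →
      (∀ j ≥ k, ‖u j‖ ≤ R) → (∀ j ≥ k, ‖u' j‖ ≤ R) →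
      moment h x (k + 1) + c ≤ moment h y (k + 1) → moment h y k + g / 2 ≤ moment h x (k + 1) →
      ∃ a b, a + τ ≤ b ∧ (∃ i ≥ k, Icc a b ⊆ Ioo (moment h x i) (moment h x (i + 1))) ∧
        (∃ j ≥ k, Icc a b ⊆ Ioo (moment h y j) (moment h y (j + 1))) ∧
        ∀ t ∈ Icc a b, J / 4 ≤ ‖z t - z' t‖ := by
  have hV := hP.speedBound_nonneg hR
  set V := speedBound P K R with hVdef
  have hg := hP.gap_pos
  -- The first two terms keep the times within 2τ of σ away from the other impulses of both orbits;
  -- the third limits the motion during 2τ to J/8.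
  let τ := min (min (c / 3) (g / 6)) (J / (16 * (V + 1)))
  have hτ : 0 < τ := by positivity
  have hτc : τ ≤ c / 3 := (min_le_left _ _).trans (min_le_left _ _)
  have hτg : τ ≤ g / 6 := (min_le_left _ _).trans (min_le_right _ _)
  have hτJ : V * (2 * τ) ≤ J / 8 := by
    have h1 : τ ≤ J / (16 * (V + 1)) := min_le_right _ _
    rw [le_div_iff₀ (by positivity)] at h1
    nlinarith
  refine ⟨τ, hτ, fun x y u u' z z' k hz hz' hu hu' hxy hyx => ?_⟩
  have hx1 := hP.moment_add_gap_le x k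
  have hx2 := hP.moment_add_gap_le x (k + 1)
  set σ := moment h x (k + 1) with hσ
  have hσx : σ ∈ Ioc (moment h x k) (moment h x (k + 1)) := ⟨by linarith, le_rfl⟩
  have hσy : σ ∈ Ioc (moment h y k) (moment h y (k + 1)) := ⟨by linarith, by linarith⟩
  have hspeed : ∀ {w : EuclideanSpace ℝ (Fin n)} {s t : ℝ}, ‖w‖ ≤ R → s ∈ Icc (0 : ℝ) 2 →
      t ∈ Icc (0 : ℝ) 2 → |t - s| ≤ 2 * τ → ‖φ w t - φ w s‖ ≤ J / 8 := fun hw hs ht hst =>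
    (hP.norm_flow_sub_le hw hs ht).trans ((mul_le_mul_of_nonneg_left hst hV).trans hτJ)
  have hspeed' : ∀ {t}, t ∈ Ioc (moment h y k) (moment h y (k + 1)) → |t - σ| ≤ 2 * τ →
      ‖z' t - z' σ‖ ≤ J / 8 := fun {t} ht hst => by
    rw [hz'.eq_flow k t ht, hz'.eq_flow k σ hσy]
    exact hspeed (hu' k le_rfl) (hP.sub_mem hσy) (hP.sub_mem ht) (by simpa using hst)
  have hjmp : u (k + 1) = P.jump (z σ) := by
    rw [hz.succ, hz.eq_flow k σ hσx, hσ, moment_succ_eq_add_gap, add_sub_cancel_left]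
    rfl
  have hJσ : J ≤ ‖u (k + 1) - z σ‖ := by
    rw [hjmp]
    refine hjump _ ?_
    rw [hz.eq_flow k σ hσx]
    exact hP.norm_flow_le (hu k le_rfl) (hP.sub_mem hσx)
  have htri : ‖u (k + 1) - z σ‖ ≤ ‖u (k + 1) - z' σ‖ + ‖z σ - z' σ‖ := by
    have := norm_sub_le_norm_sub_add_norm_sub (u (k + 1)) (z' σ) (z σ)
    rwa [norm_sub_rev (z' σ)] at this
  -- The value z' σ is at least J/2 away from one of the one-sided values of z at σ. On that side,
  -- at distances from τ to 2τ, the two motions leave J/2 - 2·J/8 = J/4.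
  rcases le_or_gt (J / 2) ‖u (k + 1) - z' σ‖ with hcase | hcase
  · refine ⟨σ + τ, σ + 2 * τ, by linarith, ⟨k + 1, by lia, fun t ht => ?_⟩,
      ⟨k, le_rfl, fun t ht => ?_⟩, fun t ht => ?_⟩
    · exact ⟨by linarith [ht.1], by linarith [ht.2]⟩
    · exact ⟨by linarith [ht.1], by linarith [ht.2]⟩
    · have htx : t ∈ Ioc (moment h x (k + 1)) (moment h x (k + 1 + 1)) :=
        ⟨by linarith [ht.1], by linarith [ht.2]⟩
      have h1 : ‖z t - u (k + 1)‖ ≤ J / 8 := by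
        rw [hz.eq_flow (k + 1) t htx, ← hσ]
        have := hspeed (w := u (k + 1)) (s := 0) (t := t - σ) (hu (k + 1) (by lia)) (by simp)
          (hP.sub_mem htx) (by rw [abs_le]; constructor <;> linarith [ht.1, ht.2])
        rwa [hP.flow.zero] at this
      have h2 := hspeed' (t := t) ⟨by linarith [ht.1], by linarith [ht.2]⟩
        (by rw [abs_le]; constructor <;> linarith [ht.1, ht.2])
      have h3 := norm_sub_le_norm_sub_add_norm_sub (u (k + 1)) (z t) (z' σ)
      have h4 := norm_sub_le_norm_sub_add_norm_sub (z t) (z' t) (z' σ)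
      rw [norm_sub_rev] at h1
      linarith
  · have hcase' : J / 2 ≤ ‖z σ - z' σ‖ := by linarith
    refine ⟨σ - 2 * τ, σ - τ, by linarith, ⟨k, le_rfl, fun t ht => ?_⟩,
      ⟨k, le_rfl, fun t ht => ?_⟩, fun t ht => ?_⟩
    · exact ⟨by linarith [ht.1], by linarith [ht.2]⟩
    · exact ⟨by linarith [ht.1], by linarith [ht.2]⟩
    · have htx : t ∈ Ioc (moment h x k) (moment h x (k + 1)) :=
        ⟨by linarith [ht.1], by linarith [ht.2]⟩
      have hst : |t - σ| ≤ 2 * τ := by rw [abs_le]; constructor <;> linarith [ht.1, ht.2]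
      have h1 : ‖z t - z σ‖ ≤ J / 8 := by
        rw [hz.eq_flow k t htx, hz.eq_flow k σ hσx]
        exact hspeed (hu k le_rfl) (hP.sub_mem hσx) (hP.sub_mem htx) (by simpa using hst)
      have h2 := hspeed' (t := t) ⟨by linarith [ht.1], by linarith [ht.2]⟩ hst
      have h3 := norm_sub_le_norm_sub_add_norm_sub (z σ) (z t) (z' σ)
      have h4 := norm_sub_le_norm_sub_add_norm_sub (z t) (z' t) (z' σ)
      rw [norm_sub_rev] at h1
      linarith

/-- Impulses have a minimal size on bounded sets. -/
theorem exists_jump_lower_bound (hP : P.IsDissipative h φ K g C r)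
    (hne : ∀ x, P.opB x + P.W x ≠ 0) (R : ℝ) :
    ∃ J > 0, ∀ x, ‖x‖ ≤ R → J ≤ ‖P.jump x - x‖ := by
  rcases lt_or_ge R 0 with hR | hR
  · exact ⟨1, one_pos, fun x hx => absurd (norm_nonneg x) (by linarith)⟩
  have hc : Continuous fun x => ‖P.jump x - x‖ :=
    (hP.lipschitz_jump.continuous.sub continuous_id).norm
  obtain ⟨x₀, -, hx₀⟩ := (isCompact_closedBall (0 : EuclideanSpace ℝ (Fin n)) R).exists_isMinOn
    (Metric.nonempty_closedBall.2 hR) hc.continuousOn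
  refine ⟨_, norm_pos_iff.2 ?_, fun x hx => hx₀ (by simpa using hx)⟩
  simpa [jump] using hne x₀

theorem sensitiveOnPC (hP : P.IsDissipative h φ K g C r) {S : Λ ≃ₜ (ℕ → Fin 2)}
    (hS : ∀ x, S (h x) = shiftMap (S x)) (hne : ∀ x, P.opB x + P.W x ≠ 0) :
    P.SensitiveOnPC h := by
  obtain ⟨R₀, hR₀, hR, -⟩ := hP.exists_radius
  have hg := hP.gap_pos
  obtain ⟨J, hJ, hjump⟩ := hP.exists_jump_lower_bound hne (flowBound P K (R₀ + 1))
  obtain ⟨c₀, hc₀, hsep⟩ := exists_code_separation S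
  -- The term c₀ makes different symbols imply separation. The term g/2 ensures that, just before
  -- the first separation, the last moment of either orbit is at least g/2 before the next moment of
  -- the other.
  obtain ⟨τ, hτ, key⟩ := hP.exists_separation (c := min c₀ (g / 2)) (by positivity) hJ
    (by positivity) hjump
  refine ⟨J / 8, by positivity, τ, hτ, fun ζ hζ z hz δ hδ H hH => ?_⟩
  obtain ⟨κ, -, -, hm⟩ := exists_of_mem_impulseSequences hζ
  have hζ0 : ζ 0 = κ 0 := by simpa using hm 0
  set x := κ 0
  have ho := hP.isForwardOrbit hm hz
  let ρ := K * (‖z (ζ 0)‖ + H) + ‖P.jump 0‖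
  have hρ : ∀ w, ‖w‖ ≤ ‖z (ζ 0)‖ + H → ‖P.jump w‖ ≤ ρ := fun w hw =>
    (hP.norm_jump_le w).trans (by simp only [ρ]; gcongr)
  have hlim := hP.contracting.tendsto_const_mul ρ
  have hlim' := (hP.contracting.tendsto_const_mul (2 * ρ)).const_mul (Real.exp (K * 2))
  rw [mul_zero] at hlim'
  -- After k₀ impulses all admitted states are in the ball of radius R₀ + 1, and admitted solutions
  -- with the same moments differ by less than J/8.
  obtain ⟨k₀, hk₀⟩ := eventually_atTop.1 ((hlim.eventually (gt_mem_nhds one_pos)).and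
    (hlim'.eventually (gt_mem_nhds (by positivity : 0 < J / 8))))
  have hbd : ∀ {y : Λ} {u : ℕ → EuclideanSpace ℝ (Fin n)} {w : ℝ → EuclideanSpace ℝ (Fin n)},
      P.IsForwardOrbit h φ y u w → ‖u 0‖ ≤ ρ → ∀ k ≥ k₀, ‖u k‖ ≤ R₀ + 1 := by
    intro y u w hw hu k hk
    rw [eq_evolution hw.succ]
    have h1 : C * r ^ k * ‖u 0‖ ≤ C * r ^ k * ρ := mul_le_mul_of_nonneg_left hu
      (mul_nonneg hP.contracting.nonneg (pow_nonneg hP.contracting.rate_nonneg k))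
    linarith [hR y k (u 0), (hk₀ k hk).1]
  obtain ⟨y, hxy, k, hk, hck, hfirst⟩ := exists_separating_point hS
    (c := min c₀ (g / 2)) (by positivity)
    (fun x y hxy => hsep x y (hxy.trans_le (min_le_left _ _))) x hδ (k₀ + 1)
  obtain ⟨k, rfl⟩ : ∃ k', k = k' + 1 := ⟨k - 1, by lia⟩
  have hm' : ∀ k : ℕ, (fun i : ℤ => moment h y i.toNat) k = moment h y k := fun k => by simp
  -- Q has to be fixed before z₁ is given. It is found for the reference solution w with initial
  -- moment y and the initial value of z; every admitted z₁ is then within J/8 of w on Q, which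
  -- leaves J/4 - J/8.
  obtain ⟨w, hw, hw0⟩ := exists_isForwardSolution hP.subset hP.flow hP.gap_pos hP.gap_le
    (ζ := fun i : ℤ => moment h y i.toNat) (x := y) hm'
    (z (ζ 0))
  have hw0' : w y = z (ζ 0) := by
    rw [← hw0]
    simp
  have ho' := hP.isForwardOrbit (ζ := fun i : ℤ => moment h y i.toNat) (x := y) hm' hw
  have hu : ‖P.jump (z (moment h x 0))‖ ≤ ρ := by
    rw [moment_zero, ← hζ0]
    exact hρ _ (by linarith)
  have hu' : ‖P.jump (w (moment h y 0))‖ ≤ ρ := by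
    rw [moment_zero, hw0']
    exact hρ _ (by linarith)
  have hb := hbd ho hu
  have hb' := hbd ho' hu'
  have hmom : ∀ j, (h^[j] x : ℝ) - h^[j] y = moment h x j - moment h y j := fun j => by
    simp [moment]
  have hprev := hfirst k k.lt_succ_self
  rw [hmom, abs_lt] at hprev
  have hgc : min c₀ (g / 2) ≤ g / 2 := min_le_right _ _
  have hgx := hP.moment_add_gap_le x k
  have hgy := hP.moment_add_gap_le y k
  obtain ⟨a, b, hab, ⟨i, hi, hix⟩, ⟨j, hj, hjy⟩, hQ⟩ : ∃ a b, a + τ ≤ b ∧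
      (∃ i ≥ k, Icc a b ⊆ Ioo (moment h x i) (moment h x (i + 1))) ∧
      (∃ j ≥ k, Icc a b ⊆ Ioo (moment h y j) (moment h y (j + 1))) ∧
      ∀ t ∈ Icc a b, J / 4 ≤ ‖z t - w t‖ := by
    rw [hmom, le_abs] at hck
    -- The orbit whose impulse comes first plays the role of the jumping one.
    rcases hck with hck | hck
    · obtain ⟨a, b, hab, hi, hj, hQ⟩ := key y x _ _ w z k ho' ho
        (fun j hj => hb' j (by lia)) (fun j hj => hb j (by lia)) (by linarith)
        (by linarith [hprev.2])
      exact ⟨a, b, hab, hj, hi, fun t ht => by rw [norm_sub_rev]; exact hQ t ht⟩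
    · exact key x y _ _ z w k ho ho'
        (fun j hj => hb j (by lia)) (fun j hj => hb' j (by lia)) (by linarith)
        (by linarith [hprev.1])
  have haQ : a ∈ Icc a b := ⟨le_rfl, by linarith⟩
  refine ⟨y, y.2, by rwa [hζ0], a, b, ?_, ?_, by linarith, ?_, fun η hη hη0 => ?_⟩
  · rw [hζ0, ← moment_zero (h := h) x]
    exact ((hP.strictMono x).monotone i.zero_le).trans (hix haQ).1.le
  · rw [← moment_zero (h := h) y]
    exact ((hP.strictMono y).monotone j.zero_le).trans (hjy haQ).1.le
  · refine (hP.strictMono_impulse hζ).notMem_Icc_of_subset_Ioo (j := i) ?_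
    have h1 := hm (i + 1)
    push_cast at h1
    rwa [hm, h1]
  · obtain ⟨κ₁, -, -, hm₁⟩ := exists_of_mem_impulseSequences hη
    have hy₁ : κ₁ 0 = y := Subtype.ext (by
      rw [← hη0]
      simpa using (hm₁ 0).symm)
    rw [hy₁] at hm₁
    refine ⟨(hP.strictMono_impulse hη).notMem_Icc_of_subset_Ioo (j := j) ?_,
      fun z₁ hz₁ hH₁ t ht => ?_⟩
    · have h1 := hm₁ (j + 1)
      push_cast at h1
      rwa [hm₁, h1]
    · have ho₁ := hP.isForwardOrbit hm₁ hz₁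
      have h1 := hP.norm_sub_le ho₁ ho' (Ioo_subset_Ioc_self (hjy ht))
      have hu₁ : ‖P.jump (z₁ (moment h y 0))‖ ≤ ρ := by
        rw [moment_zero, ← hη0]
        refine hρ _ ?_
        have := norm_sub_norm_le (z₁ (η 0)) (z (ζ 0))
        rw [norm_sub_rev] at this
        linarith
      have h2 : ‖P.jump (z₁ (moment h y 0)) - P.jump (w (moment h y 0))‖ ≤ 2 * ρ := by
        linarith [_root_.norm_sub_le (P.jump (z₁ (moment h y 0))) (P.jump (w (moment h y 0)))]
      have h3 : ‖z₁ t - w t‖ ≤ Real.exp (K * 2) * (C * r ^ j * (2 * ρ)) := h1.trans <| by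
        gcongr
        exact mul_nonneg hP.contracting.nonneg (pow_nonneg hP.contracting.rate_nonneg j)
      have h4 := (hk₀ j (by lia)).2
      have h5 := hQ t ht
      have h6 := norm_sub_le_norm_sub_add_norm_sub (z t) (z₁ t) (w t)
      rw [norm_sub_rev (z t) (z₁ t)] at h6
      linarith

/-- Bounded solutions share one bound M, so any two initial values are closer than H = 2|M| + 1. -/
theorem sensitiveOnPCB (hP : P.IsDissipative h φ K g C r) {S : Λ ≃ₜ (ℕ → Fin 2)}
    (hS : ∀ x, S (h x) = shiftMap (S x)) (hne : ∀ x, P.opB x + P.W x ≠ 0) :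
    P.SensitiveOnPCB h := by
  obtain ⟨M, hM⟩ := hP.exists_uniform_bound
  obtain ⟨ε₀, hε₀, ε₁, hε₁, key⟩ := hP.sensitiveOnPC hS hne
  refine ⟨ε₀, hε₀, ε₁, hε₁, fun ζ hζ z hz δ hδ => ?_⟩
  obtain ⟨t₁, ht₁, hd, a, b, h1, h2, h3, h4, h5⟩ := key ζ hζ z
    (hz.1.isForwardSolution (hP.strictMono_impulse hζ)) δ hδ (2 * |M| + 1) (by positivity)
  refine ⟨t₁, ht₁, hd, a, b, h1, h2, h3, h4, fun η hη hη0 => ⟨(h5 η hη hη0).1,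
    fun z₁ hz₁ t ht => ?_⟩⟩
  rw [norm_sub_rev]
  refine (h5 η hη hη0).2 z₁ (hz₁.1.isForwardSolution (hP.strictMono_impulse hη)) ?_ t ht
  have e1 := _root_.norm_sub_le (z (ζ 0)) (z₁ (η 0))
  linarith [hM ζ hζ z hz (ζ 0), hM η hη z₁ hz₁ (η 0), le_abs_self M]

theorem isChaotic (hP : P.IsDissipative h φ K g C r) {S : Λ ≃ₜ (ℕ → Fin 2)}
    (hS : ∀ x, S (h x) = shiftMap (S x)) (hne : ∀ x, P.opB x + P.W x ≠ 0) : P.IsChaotic h :=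
  ⟨⟨hP.isAttractorPCB, hP.sensitiveOnPCB hS hne, hP.periodicDenseInPCB hS,
    hP.hasDenseOrbitInPCB hS⟩, hP.sensitiveOnPC hS hne, hP.periodicDenseInPC hS,
    hP.hasDenseOrbitInPC hS⟩

end IsDissipative

end ImpulsiveSystem

/-! ### The constants of the exponential decay -/

namespace ImpulsiveSystem

open scoped NNReal

variable {n : ℕ} {P : ImpulsiveSystem n} {Λ : Set ℝ} {h : Λ → Λ}

theorem ncard_moments_between {ζ : ℤ → ℝ} (hζ : StrictMono ζ) {k : ℕ} {s t : ℝ}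
    (hs : s ∈ Ioc (ζ 0) (ζ 1)) (ht : t ∈ Ioc (ζ k) (ζ (k + 1))) :
    {i : ℤ | s ≤ ζ i ∧ ζ i < t}.ncard = k := by
  have : {i : ℤ | s ≤ ζ i ∧ ζ i < t} = (Finset.Icc (1 : ℤ) k : Set ℤ) := by
    ext i
    simp only [mem_ofPred_eq, Finset.coe_Icc, mem_Icc]
    refine ⟨fun ⟨h1, h2⟩ => ?_, fun ⟨h1, h2⟩ => ?_⟩
    · have h3 := hζ.lt_iff_lt.1 (hs.1.trans_le h1)
      have h4 := hζ.lt_iff_lt.1 (h2.trans_le ht.2)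
      lia
    · exact ⟨hs.2.trans (hζ.monotone h1), (hζ.monotone h2).trans_lt ht.1⟩
  rw [this, Set.ncard_coe_finset, Int.card_Icc]
  lia

theorem hasTransitionBound {S : Λ ≃ₜ (ℕ → Fin 2)} (hS : ∀ x, S (h x) = shiftMap (S x)) {g : ℝ}
    (hg : 0 < g) (hgap : ∀ x : Λ, g ≤ 1 + (h x : ℝ) - x) {N ω : ℝ}
    (hZ : ∀ ζ ∈ impulseSequences h, ∀ s t : ℝ, s ≤ t →
      ‖P.transition ζ t s‖ ≤ N * Real.exp (-ω * (t - s))) :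
    HasTransitionBound h P.opA P.opB N ω := by
  intro x k s hs t ht hst
  obtain ⟨κ, hκ, rfl⟩ := exists_orbit hS x
  have hζ : (fun i : ℤ => (i : ℝ) + κ i) ∈ impulseSequences h := ⟨κ, hκ, fun _ => rfl⟩
  obtain ⟨ζ, hζeq⟩ : ∃ ζ : ℤ → ℝ, ζ = fun i : ℤ => (i : ℝ) + κ i := ⟨_, rfl⟩
  rw [← hζeq] at hζ
  obtain ⟨κ', -, hζκ, hm⟩ := exists_of_mem_impulseSequences hζ
  have h0 : κ' 0 = κ 0 := Subtype.ext (by simpa [hζeq] using (hζκ 0).symm)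
  rw [h0] at hm
  have hmono := strictMono_of_mem_impulseSequences hg hgap hζ
  have hmx := moment_strictMono hg hgap (κ 0)
  -- `transition` counts exactly k impulses only for times in half-open intervals. Moving s and t
  -- slightly towards the right ends of their intervals achieves this, and θ → 0 yields the bound
  -- for the closed intervals, in particular just after an impulse.
  let a : ℝ → ℝ := fun θ => s + θ * (moment h (κ 0) 1 - s)
  let b : ℝ → ℝ := fun θ => t + θ * (moment h (κ 0) (k + 1) - t)
  have hle : moment h (κ 0) 1 ≤ moment h (κ 0) (k + 1) := hmx.monotone (by lia)
  have key : ∀ θ ∈ Ioo (0 : ℝ) 1,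
      ‖NormedSpace.exp ((b θ - a θ) • P.opA) * (1 + P.opB) ^ k‖ ≤
        N * Real.exp (-ω * (b θ - a θ)) := by
    intro θ hθ
    have h01 := hmx (Nat.lt_succ_self 0)
    have hkk := hmx (Nat.lt_succ_self k)
    have ha : a θ ∈ Ioc (ζ 0) (ζ 1) := by
      have e0 := hm 0
      have e1 := hm 1
      push_cast at e0 e1
      rw [e0, e1]
      simp only [a]
      constructor <;> nlinarith [hs.1, hs.2, hθ.1, hθ.2]
    have hb : b θ ∈ Ioc (ζ k) (ζ (k + 1)) := by
      have e1 := hm (k + 1)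
      push_cast at e1
      rw [hm, e1]
      simp only [b]
      constructor <;> nlinarith [ht.1, ht.2, hθ.1, hθ.2]
    have hab : a θ ≤ b θ := by
      simp only [a, b]
      nlinarith [hθ.1, hθ.2]
    have := hZ ζ hζ (a θ) (b θ) hab
    rwa [transition, ncard_moments_between hmono ha hb] at this
  have hexp : Continuous fun t : ℝ => NormedSpace.exp (t • P.opA) :=
    (differentiable_exp_smul_const ℝ P.opA).continuous
  have hba : Continuous fun θ => b θ - a θ := by fun_prop
  have hl : Tendsto (fun θ => ‖NormedSpace.exp ((b θ - a θ) • P.opA) * (1 + P.opB) ^ k‖)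
      (𝓝[>] 0) (𝓝 ‖NormedSpace.exp ((t - s) • P.opA) * (1 + P.opB) ^ k‖) := by
    have := (((hexp.comp hba).mul_const ((1 + P.opB) ^ k)).norm.tendsto 0)
    simp only [Function.comp_def, a, b, zero_mul, add_zero] at this
    exact this.mono_left nhdsWithin_le_nhds
  have hr : Tendsto (fun θ => N * Real.exp (-ω * (b θ - a θ)))
      (𝓝[>] 0) (𝓝 (N * Real.exp (-ω * (t - s)))) := by
    have := (show Continuous fun θ => N * Real.exp (-ω * (b θ - a θ)) by fun_prop).tendsto 0
    simp only [a, b, zero_mul, add_zero] at this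
    exact this.mono_left nhdsWithin_le_nhds
  exact le_of_tendsto_of_tendsto hl hr
    (Filter.eventually_of_mem (Ioo_mem_nhdsGT one_pos) key)

theorem commute_opA_opB (hAB : Commute P.A P.B) : Commute P.opA P.opB := by
  have := congrArg (Matrix.toEuclideanCLM (n := Fin n) (𝕜 := ℝ)) hAB.eq
  rw [map_mul, map_mul] at this
  exact this

theorem exists_isDissipative (hΛ : Λ ⊆ Icc 0 1) {S : Λ ≃ₜ (ℕ → Fin 2)}
    (hS : ∀ x, S (h x) = shiftMap (S x)) (hdist : ∀ x : Λ, ¬ ((x : ℝ) = 1 ∧ (h x : ℝ) = 0))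
    {L N ω : ℝ} (hL : 0 ≤ L)
    (hlip : ∀ x₁ x₂, ‖P.f x₁ - P.f x₂‖ + ‖P.W x₁ - P.W x₂‖ ≤ L * ‖x₁ - x₂‖)
    (hbdd : BddAbove (range fun x => ‖P.f x‖)) (hAB : Commute P.A P.B) (hN : 0 ≤ N)
    (hZ : ∀ ζ ∈ impulseSequences h, ∀ s t : ℝ, s ≤ t →
      ‖P.transition ζ t s‖ ≤ N * Real.exp (-ω * (t - s)))
    (hneg : -ω + N * L + Real.log (1 + N * L) < 0) :
    ∃ φ K g C r, P.IsDissipative h φ K g C r := by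
  obtain ⟨g, hg, hgap⟩ := exists_gap hΛ hS hdist
  have hf : ∀ x y, ‖P.f x - P.f y‖ ≤ L * ‖x - y‖ := fun x y =>
    (le_add_of_nonneg_right (norm_nonneg _)).trans (hlip x y)
  have hW : ∀ x y, ‖P.W x - P.W y‖ ≤ L * ‖x - y‖ := fun x y =>
    (le_add_of_nonneg_left (norm_nonneg _)).trans (hlip x y)
  have toLip : ∀ {F : EuclideanSpace ℝ (Fin n) → EuclideanSpace ℝ (Fin n)},
      (∀ x y, ‖F x - F y‖ ≤ L * ‖x - y‖) → LipschitzWith L.toNNReal F := fun hF =>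
    LipschitzWith.of_dist_le_mul fun x y => by
      rw [dist_eq_norm, dist_eq_norm, Real.coe_toNNReal _ hL]
      exact hF x y
  obtain ⟨M, hM⟩ := hbdd
  obtain ⟨φ, hφ⟩ := exists_isLocalFlow P.opA (toLip hf) (fun x => hM ⟨x, rfl⟩)
  have hfield : LipschitzWith (‖P.opA‖₊ + L.toNNReal) P.field := P.opA.lipschitz.add (toLip hf)
  have hjump : LipschitzWith (1 + (‖P.opB‖₊ + L.toNNReal)) P.jump :=
    LipschitzWith.id.add (P.opB.lipschitz.add (toLip hW))
  exact ⟨φ, max (‖P.opA‖₊ + L.toNNReal) (1 + (‖P.opB‖₊ + L.toNNReal)), g, _, _, hΛ, hφ,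
    hfield.weaken (le_max_left _ _), hjump.weaken (le_max_right _ _), hg, hgap,
    isContractingEvolution_postMap hΛ (hasTransitionBound hS hg hgap hZ) hφ
      (commute_opA_opB hAB) hN hL hf hW hneg⟩

end ImpulsiveSystem

end

/-! ### Chaos of the impulsive problem -/

theorem mainTheorem1 {n : ℕ} (P : ImpulsiveSystem n)
    -- the generator of the moments of impulses
    (Λ : Set ℝ) (hΛ : Λ ⊆ Set.Icc 0 1) (h : Λ → Λ)
    (S : Λ ≃ₜ (ℕ → Fin 2)) (hS : ∀ x, S (h x) = shiftMap (S x))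
    -- consecutive moments of impulses do not coincide
    (hdist : ∀ x : Λ, ¬ ((x : ℝ) = 1 ∧ (h x : ℝ) = 0))
    (L N ω q : ℝ) (hL : 0 < L)
    -- (C1)
    (C1 : (1 + P.B).det ≠ 0)
    -- (C2)
    (C2 : ∀ x₁ x₂, ‖P.f x₁ - P.f x₂‖ + ‖P.W x₁ - P.W x₂‖ ≤ L * ‖x₁ - x₂‖)
    -- (C3)
    (C3 : ∀ x, P.opB x + P.W x ≠ 0)
    -- (C4)
    (C4 : BddAbove (Set.range fun x => ‖P.f x‖) ∧ BddAbove (Set.range fun x => ‖P.W x‖))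
    -- (C5), and the constants of exponential decay of the transition matrices
    (C5 : Commute P.A P.B ∧ P.NegativeSpectrum)
    (hN : 0 < N) (hω : 0 < ω)
    (hZ : ∀ ζ ∈ impulseSequences h, ∀ s t : ℝ, s ≤ t →
      ‖P.transition ζ t s‖ ≤ N * Real.exp (-ω * (t - s)))
    -- (C6)
    (C6 : N * L * (2 / ω + Real.exp ω / (1 - Real.exp (-ω))) < 1)
    -- (C7)
    (C7 : -ω + N * L + Real.log (1 + N * L) < 0)
    -- (C8)
    (hq : 3 ≤ q) (hq' : 1 / q < 2 * P.mLower / (3 * P.mUpper))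
    (C8 : L < (2 * P.mLower / (3 * P.mUpper) - 1 / q) * P.mLower * P.minJump (P.M₁ N ω) /
      (2 * P.M₁ N ω * (P.mUpper + P.mLower))) :
    P.IsChaotic h := by
  obtain ⟨φ, K, g, C, r, hP⟩ := ImpulsiveSystem.exists_isDissipative hΛ hS hdist hL.le C2 C4.1
    C5.1 hN.le hZ C7
  exact hP.isChaotic hS C3
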